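/- Let $n\ge 1$ and let $a_1<a_2<\dots<a_n$ be natural numbers that are multiplicatively independent, i.e. the products $a_1^{q_1}\cdots a_n^{q_n}$ with $(q_1,\dots,q_n)\in\mathbb{N}_0^n$ are pairwise distinct (in particular all $a_k\ge 2$; this holds for instance if all $a_k\ge2$ and the $a_k$ are pairwise coprime). For real $x\ge 1$ put $$N(x)=\#\{(q_1,\dots,q_n)\in\mathbb{N}_0^n : a_1^{q_1}\cdots a_n^{q_n}\le x\},\qquad S=\{a_1^{q_1}\cdots a_n^{q_n}: q_1,\dots,q_n\in\mathbb{N}_0\},$$ let $\chi_S$ be the characteristic function of $S$, and let $B_1^*(\{y\})=\{y\}-\tfrac12$ if $y\notin\mathbb{Z}$ and $B_1^*(\{y\})=0$ if $y\in\mathbb{Z}$, where $\{y\}$ is the fractional part of $y$. For real $R>0$ put $$\Sigma_R(x)=\sum_{m=1}^{n}\ \sum_{r=1}^{n-1}\ \sum_{\substack{I\subset\{1,\dots,n\}\setminus\{m\}\\ |I|=r}}\ \sum_{k=1}^{\lfloor R\log a_m\rfloor}\frac{\sin\left(2\pi k\frac{\log x}{\log a_m}-\frac{\pi r}{2}\right)}{k}\prod_{l\in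 I}\cot\left(\frac{\pi k\log a_l}{\log a_m}\right).$$ For $\delta>0$ let $\mathcal{R}_\delta$ be the set of real $R$ such that $|R\log a_m-k|\ge\delta$ for all $1\le m\le n$ and all $k\in\mathbb{Z}$. Then $\mathcal{R}_\delta$ is unbounded above for every $\delta<\frac1{2n}$, and for every real $x\ge1$ and every $\delta>0$ $$N(x)=\operatorname*{Res}_{s=0}\left(\frac{x^s}{s\prod_{k=1}^n\left(1-a_k^{-s}\right)}\right)-\frac{1}{2^{n-1}}\sum_{k=1}^n B_1^*\left(\left\{\frac{\log x}{\log a_k}\right\}\right)+\frac{1}{2^{n-1}\pi}\lim_{\substack{R\to\infty\\ R\in\mathcal{R}_\delta}}\Sigma_R(x)+\frac12\chi_S(x).$$ -/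

import Mathlib

open Filter Topology

noncomputable section

namespace SmoothCount

/-- The residue of `f` at an isolated singularity `z₀`: the (eventually constant) value of
`(2πi)⁻¹ ∮ f` over circles around `z₀` of small radius. -/
def residue (f : ℂ → ℂ) (z₀ : ℂ) : ℂ :=
  limUnder (𝓝[>] (0 : ℝ))
    (fun ρ : ℝ => (2 * (Real.pi : ℂ) * Complex.I)⁻¹ * ∮ z in C(z₀, ρ), f z)

/-- `B₁*({y})`: equal to `{y} - 1/2` for non-integral `y` and to `0` for integral `y`. -/
def B1star (y : ℝ) : ℝ :=
  if Int.fract y = 0 then 0 else Int.fract y - 1 / 2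

variable {n : ℕ}

/-- The product `a₁^{q₁} ⋯ aₙ^{qₙ}`. -/
def powProd (a : Fin n → ℕ) (q : Fin n → ℕ) : ℕ :=
  ∏ i, a i ^ q i

/-- The number of exponent tuples `q` with `a₁^{q₁} ⋯ aₙ^{qₙ} ≤ x`. -/
def count (a : Fin n → ℕ) (x : ℝ) : ℕ :=
  {q : Fin n → ℕ | (powProd a q : ℝ) ≤ x}.ncard

/-- The set of all products `a₁^{q₁} ⋯ aₙ^{qₙ}`, as real numbers. -/
def productSet (a : Fin n → ℕ) : Set ℝ :=
  Set.range (fun q : Fin n → ℕ => (powProd a q : ℝ))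

/-- The characteristic function of `productSet a`. -/
def chi (a : Fin n → ℕ) : ℝ → ℝ :=
  (productSet a).indicator 1

/-- The function `s ↦ x^s / (s ∏ₖ (1 - 1 / aₖ^s))`. -/
def kernel (a : Fin n → ℕ) (x : ℝ) (s : ℂ) : ℂ :=
  (x : ℂ) ^ s / (s * ∏ k, (1 - 1 / (a k : ℂ) ^ s))

/-- The partial sum up to `⌊R log aₘ⌋` of the series attached to the index `m` and to the set
`{aᵢ : i ∈ I}` of `r = |I|` further bases. -/
def partialSeries (a : Fin n → ℕ) (x : ℝ) (m : Fin n) (I : Finset (Fin n)) (R : ℝ) : ℝ :=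
  ∑ k ∈ Finset.Icc 1 ⌊R * Real.log (a m)⌋₊,
    Real.sin (2 * Real.pi * k * (Real.log x / Real.log (a m)) - Real.pi * (I.card : ℝ) / 2) / k *
      ∏ l ∈ I, Real.cot (Real.pi * k * Real.log (a l) / Real.log (a m))

/-- The sum of the truncated series over all `m`, all `1 ≤ r ≤ n - 1` and all `r`-element sets of
bases other than `aₘ`, with one common truncation parameter `R`. -/
def truncatedSum (a : Fin n → ℕ) (x R : ℝ) : ℝ :=
  ∑ m, ∑ r ∈ Finset.Icc 1 (n - 1), ∑ I ∈ (Finset.univ.erase m).powersetCard r,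
    partialSeries a x m I R

/-- The truncation parameters `R` for which every `R log aₘ` has distance at least `δ` from the
integers, that is, `R` keeps away from the points `k / log aₘ` at which a term is added. -/
def admissible (a : Fin n → ℕ) (δ : ℝ) : Set ℝ :=
  {R | ∀ m, ∀ k : ℤ, δ ≤ |R * Real.log (a m) - k|}

end SmoothCount

end

noncomputable section

namespace SmoothCount

/-! Write `L m = log aₘ` and `u = log x`, and integrate the kernel around the square with vertices
`±T ± iT`, where `T = 2πR`. Admissibility of `R` keeps the boundary away from the poles. The formula
results from evaluating this integral in two ways.

By residues (`squareIntegral_expKernel`): the poles in the square are `0` and the points `2πik / L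
m` with `0 < |k| < R L m`. Multiplicative independence makes the `L m` pairwise incommensurable, so
the nonzero poles are simple and distinct. Since `(1 - e^{-2iθ})⁻¹ = (1 - i cot θ) / 2`, expanding
the product over `l ≠ m` turns each pair of residues at `±k` into a sum over subsets `I` of sines
times cotangents (`sum_simpleResidue`). The terms with `I = ∅` form the Fourier series of the
sawtooth (`tendsto_sum_sin_div`) and produce the `B1star` terms; the other terms are `truncatedSum`.

By asymptotics (`tendsto_squareIntegral_expKernel`): on the left half the denominator grows
exponentially and the integral tends to `0`. On the right half the kernel differs from the finite
sum of `e^{(u - ∑ qₘ L m) s} / s` over a large box of exponents `q` by an exponentially decaying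
remainder. Each summand is a truncated Perron integral and tends to `2πi` times a step function with
value `1/2` at its jump, so the sum counts the products up to `x` with weight `1/2` at `x` itself
(`sum_step_eq`).

Comparing the two yields both the convergence of `truncatedSum` along admissible `R` and the value
of its limit. That admissible `R` exist arbitrarily far out is a measure estimate
(`exists_admissibleFor`). -/

/-! ### Integrals along half of the boundary of a square -/

/-- The integral of `f` along the right half `-iT → T - iT → T + iT → iT` of the boundary of the
square with vertices `±T ± iT`. -/
def halfSquareIntegral (f : ℂ → ℂ) (T : ℝ) : ℂ :=
  (∫ σ in (0 : ℝ)..T, f (σ + (-T : ℝ) * Complex.I))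
    + Complex.I * (∫ t in (-T)..T, f (T + t * Complex.I))
    - ∫ σ in (0 : ℝ)..T, f (σ + T * Complex.I)

/-- The integral of `f` along the whole boundary of the square with vertices `±T ± iT`. -/
def squareIntegral (f : ℂ → ℂ) (T : ℝ) : ℂ :=
  halfSquareIntegral f T - halfSquareIntegral (fun s => f (-s)) T

/-- The right half of the boundary of the square with vertices `±T ± iT`. -/
def halfSquare (T : ℝ) : Set ℂ :=
  {s | 0 ≤ s.re ∧ s.re ≤ T ∧ |s.im| ≤ T ∧ (|s.im| = T ∨ s.re = T)}

theorem bottom_mem_halfSquare {T σ : ℝ} (hσ : σ ∈ Set.Icc 0 T) :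
    (σ : ℂ) + (-T : ℝ) * Complex.I ∈ halfSquare T := by
  have hT : |T| = T := abs_of_nonneg (hσ.1.trans hσ.2)
  simp [halfSquare, hσ.1, hσ.2, hT]

theorem top_mem_halfSquare {T σ : ℝ} (hσ : σ ∈ Set.Icc 0 T) :
    (σ : ℂ) + T * Complex.I ∈ halfSquare T := by
  have hT : |T| = T := abs_of_nonneg (hσ.1.trans hσ.2)
  simp [halfSquare, hσ.1, hσ.2, hT]

theorem right_mem_halfSquare {T t : ℝ} (ht : t ∈ Set.Icc (-T) T) :
    (T : ℂ) + t * Complex.I ∈ halfSquare T := by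
  have : |t| ≤ T := abs_le.2 ht
  have hT : 0 ≤ T := (abs_nonneg t).trans this
  simp [halfSquare, hT, this]

theorem le_norm_of_mem_halfSquare {T : ℝ} {s : ℂ} (hs : s ∈ halfSquare T) : T ≤ ‖s‖ := by
  rcases hs.2.2.2 with h | h
  · exact h ▸ Complex.abs_im_le_norm s
  · exact h ▸ (le_abs_self _).trans (Complex.abs_re_le_norm s)

theorem ne_zero_of_mem_halfSquare {T : ℝ} (hT : 0 < T) {s : ℂ} (hs : s ∈ halfSquare T) :
    s ≠ 0 :=
  norm_pos_iff.1 (hT.trans_le (le_norm_of_mem_halfSquare hs))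

theorem intervalIntegrable_bottom {f : ℂ → ℂ} {T : ℝ} (hT : 0 ≤ T)
    (hf : ContinuousOn f (halfSquare T)) :
    IntervalIntegrable (fun σ : ℝ => f (σ + (-T : ℝ) * Complex.I)) MeasureTheory.volume 0 T := by
  apply ContinuousOn.intervalIntegrable
  rw [Set.uIcc_of_le hT]
  exact hf.comp (by fun_prop) fun σ hσ => bottom_mem_halfSquare hσ

theorem intervalIntegrable_top {f : ℂ → ℂ} {T : ℝ} (hT : 0 ≤ T)
    (hf : ContinuousOn f (halfSquare T)) :
    IntervalIntegrable (fun σ : ℝ => f (σ + T * Complex.I)) MeasureTheory.volume 0 T := by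
  apply ContinuousOn.intervalIntegrable
  rw [Set.uIcc_of_le hT]
  exact hf.comp (by fun_prop) fun σ hσ => top_mem_halfSquare hσ

theorem intervalIntegrable_right {f : ℂ → ℂ} {T : ℝ} (hT : 0 ≤ T)
    (hf : ContinuousOn f (halfSquare T)) :
    IntervalIntegrable (fun t : ℝ => f (T + t * Complex.I)) MeasureTheory.volume (-T) T := by
  apply ContinuousOn.intervalIntegrable
  rw [Set.uIcc_of_le (by linarith)]
  exact hf.comp (by fun_prop) fun t ht => right_mem_halfSquare ht

theorem halfSquareIntegral_congr {f g : ℂ → ℂ} {T : ℝ} (hT : 0 ≤ T)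
    (h : Set.EqOn f g (halfSquare T)) : halfSquareIntegral f T = halfSquareIntegral g T := by
  unfold halfSquareIntegral
  congr 1
  · congr 1
    · refine intervalIntegral.integral_congr fun σ hσ => ?_
      rw [Set.uIcc_of_le hT] at hσ
      exact h (bottom_mem_halfSquare hσ)
    · congr 1
      refine intervalIntegral.integral_congr fun t ht => ?_
      rw [Set.uIcc_of_le (by linarith)] at ht
      exact h (right_mem_halfSquare ht)
  · refine intervalIntegral.integral_congr fun σ hσ => ?_
    rw [Set.uIcc_of_le hT] at hσ
    exact h (top_mem_halfSquare hσ)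

theorem halfSquareIntegral_add {f g : ℂ → ℂ} {T : ℝ} (hT : 0 ≤ T)
    (hf : ContinuousOn f (halfSquare T)) (hg : ContinuousOn g (halfSquare T)) :
    halfSquareIntegral (fun s => f s + g s) T
      = halfSquareIntegral f T + halfSquareIntegral g T := by
  unfold halfSquareIntegral
  rw [intervalIntegral.integral_add (intervalIntegrable_bottom hT hf)
      (intervalIntegrable_bottom hT hg),
    intervalIntegral.integral_add (intervalIntegrable_top hT hf) (intervalIntegrable_top hT hg),
    intervalIntegral.integral_add (intervalIntegrable_right hT hf)
      (intervalIntegrable_right hT hg)]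
  ring

theorem halfSquareIntegral_const_mul (c : ℂ) (f : ℂ → ℂ) (T : ℝ) :
    halfSquareIntegral (fun s => c * f s) T = c * halfSquareIntegral f T := by
  unfold halfSquareIntegral
  simp only [intervalIntegral.integral_const_mul]
  ring

theorem halfSquareIntegral_sum {ι : Type*} (P : Finset ι) {f : ι → ℂ → ℂ} {T : ℝ} (hT : 0 ≤ T)
    (hf : ∀ i ∈ P, ContinuousOn (f i) (halfSquare T)) :
    halfSquareIntegral (fun s => ∑ i ∈ P, f i s) T = ∑ i ∈ P, halfSquareIntegral (f i) T := by
  classical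
  induction P using Finset.induction_on with
  | empty => simp [halfSquareIntegral]
  | insert i P hi ih =>
    simp only [Finset.sum_insert hi]
    rw [← ih fun j hj => hf j (Finset.mem_insert_of_mem hj)]
    exact halfSquareIntegral_add hT (hf i (Finset.mem_insert_self _ _))
      (continuousOn_finsetSum P fun j hj => hf j (Finset.mem_insert_of_mem hj))

/-- Continuity on the whole boundary of the square. -/
def SquareContinuous (f : ℂ → ℂ) (T : ℝ) : Prop :=
  ContinuousOn f (halfSquare T) ∧ ContinuousOn (fun s => f (-s)) (halfSquare T)

theorem squareContinuous_of_continuousAt {f : ℂ → ℂ} {T : ℝ}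
    (h : ∀ s ∈ halfSquare T, ContinuousAt f s ∧ ContinuousAt f (-s)) : SquareContinuous f T :=
  ⟨fun s hs => (h s hs).1.continuousWithinAt, fun s hs =>
    ((h s hs).2.comp (f := fun s => -s) continuousAt_neg).continuousWithinAt⟩

theorem squareIntegral_congr {f g : ℂ → ℂ} {T : ℝ} (hT : 0 ≤ T)
    (h : ∀ s ∈ halfSquare T, f s = g s ∧ f (-s) = g (-s)) :
    squareIntegral f T = squareIntegral g T := by
  unfold squareIntegral
  rw [halfSquareIntegral_congr hT fun s hs => (h s hs).1,
    halfSquareIntegral_congr hT fun s hs => (h s hs).2]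

theorem squareIntegral_add {f g : ℂ → ℂ} {T : ℝ} (hT : 0 ≤ T)
    (hf : SquareContinuous f T) (hg : SquareContinuous g T) :
    squareIntegral (fun s => f s + g s) T = squareIntegral f T + squareIntegral g T := by
  unfold squareIntegral
  rw [halfSquareIntegral_add hT hf.1 hg.1, halfSquareIntegral_add hT hf.2 hg.2]
  ring

theorem squareIntegral_const_mul (c : ℂ) (f : ℂ → ℂ) (T : ℝ) :
    squareIntegral (fun s => c * f s) T = c * squareIntegral f T := by
  unfold squareIntegral
  simp only [halfSquareIntegral_const_mul]
  ring

theorem squareIntegral_sum {ι : Type*} (P : Finset ι) {f : ι → ℂ → ℂ} {T : ℝ} (hT : 0 ≤ T)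
    (hf : ∀ i ∈ P, SquareContinuous (f i) T) :
    squareIntegral (fun s => ∑ i ∈ P, f i s) T = ∑ i ∈ P, squareIntegral (f i) T := by
  unfold squareIntegral
  rw [halfSquareIntegral_sum P hT fun i hi => (hf i hi).1,
    halfSquareIntegral_sum P hT (f := fun i s => f i (-s)) fun i hi => (hf i hi).2,
    Finset.sum_sub_distrib]

/-- Each horizontal side contributes at most `C / (cT)`. The vertical side has length `2T`, and
`e^{-cT} ≤ 1 / (cT)` bounds its share by twice that. -/
theorem norm_halfSquareIntegral_le {f : ℂ → ℂ} {T C c : ℝ} (hT : 0 < T) (hc : 0 < c)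
    (hC : 0 ≤ C) (h : ∀ s ∈ halfSquare T, ‖f s‖ ≤ C / T * Real.exp (-c * s.re)) :
    ‖halfSquareIntegral f T‖ ≤ 4 * C / c / T := by
  have hexp : ∫ σ in (0 : ℝ)..T, C / T * Real.exp (-c * σ) ≤ C / c / T := by
    have h1 : ∫ σ in (0 : ℝ)..T, C / T * Real.exp (-c * σ)
        = C / c / T * (1 - Real.exp (-c * T)) := by
      rw [intervalIntegral.integral_const_mul,
        intervalIntegral.integral_comp_mul_left (fun y => Real.exp y) (neg_ne_zero.2 hc.ne'),
        integral_exp]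
      simp
      field_simp
      ring
    rw [h1]
    exact mul_le_of_le_one_right (by positivity) (by linarith [Real.exp_pos (-c * T)])
  have hdom : IntervalIntegrable (fun σ : ℝ => C / T * Real.exp (-c * σ))
      MeasureTheory.volume 0 T := by
    apply Continuous.intervalIntegrable
    fun_prop
  have hb : ‖∫ σ in (0 : ℝ)..T, f (σ + (-T : ℝ) * Complex.I)‖ ≤ C / c / T := by
    refine (intervalIntegral.norm_integral_le_of_norm_le hT.le ?_ hdom).trans hexp
    refine Eventually.of_forall fun σ hσ => ?_
    simpa using h _ (bottom_mem_halfSquare ⟨hσ.1.le, hσ.2⟩)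
  have ht : ‖∫ σ in (0 : ℝ)..T, f (σ + T * Complex.I)‖ ≤ C / c / T := by
    refine (intervalIntegral.norm_integral_le_of_norm_le hT.le ?_ hdom).trans hexp
    refine Eventually.of_forall fun σ hσ => ?_
    simpa using h _ (top_mem_halfSquare ⟨hσ.1.le, hσ.2⟩)
  have hr : ‖∫ t in (-T)..T, f (T + t * Complex.I)‖ ≤ 2 * (C / c / T) := by
    have h1 : ‖∫ t in (-T)..T, f (T + t * Complex.I)‖
        ≤ C / T * Real.exp (-c * T) * |T - (-T)| := by
      refine intervalIntegral.norm_integral_le_of_norm_le_const fun t ht => ?_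
      rw [Set.uIoc_of_le (by linarith)] at ht
      simpa using h _ (right_mem_halfSquare ⟨ht.1.le, ht.2⟩)
    have h2 : Real.exp (-c * T) ≤ 1 / (c * T) := by
      rw [neg_mul, Real.exp_neg, ← one_div]
      exact one_div_le_one_div_of_le (by positivity) (by linarith [Real.add_one_le_exp (c * T)])
    refine h1.trans ?_
    rw [abs_of_pos (by linarith)]
    calc C / T * Real.exp (-c * T) * (T - -T) = 2 * C * Real.exp (-c * T) := by
          field_simp
          ring
      _ ≤ 2 * C * (1 / (c * T)) := by gcongr
      _ = 2 * (C / c / T) := by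
          field_simp
  unfold halfSquareIntegral
  refine (norm_sub_le _ _).trans ?_
  refine (add_le_add (norm_add_le _ _) le_rfl).trans ?_
  rw [norm_mul, Complex.norm_I, one_mul]
  have : 4 * C / c / T = 4 * (C / c / T) := by ring
  linarith

theorem halfSquareIntegral_eq_sub {f G : ℂ → ℂ} {T : ℝ} (hT : 0 ≤ T)
    (hf : ContinuousOn f (halfSquare T)) (hG : ∀ s ∈ halfSquare T, HasDerivAt G (f s) s) :
    halfSquareIntegral f T = G (T * Complex.I) - G (-(T * Complex.I)) := by
  have hh : ∀ (w : ℂ) (x : ℝ), HasDerivAt (fun σ : ℝ => (σ : ℂ) + w) 1 x := fun w x =>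
    (Complex.ofRealCLM.hasDerivAt (x := x)).add_const w
  have hv : ∀ (w : ℂ) (x : ℝ), HasDerivAt (fun t : ℝ => w + (t : ℂ) * Complex.I) Complex.I x := by
    intro w x
    simpa using ((Complex.ofRealCLM.hasDerivAt (x := x)).mul_const Complex.I).const_add w
  have hb : ∫ σ in (0 : ℝ)..T, f (σ + (-T : ℝ) * Complex.I)
      = G (T + (-T : ℝ) * Complex.I) - G ((0 : ℝ) + (-T : ℝ) * Complex.I) := by
    refine intervalIntegral.integral_eq_sub_of_hasDerivAt
      (f := fun σ : ℝ => G (σ + (-T : ℝ) * Complex.I)) (fun σ hσ => ?_)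
      (intervalIntegrable_bottom hT hf)
    rw [Set.uIcc_of_le hT] at hσ
    simpa [Function.comp_def] using (hG _ (bottom_mem_halfSquare hσ)).comp σ (hh ((-T : ℝ) * Complex.I) σ)
  have ht : ∫ σ in (0 : ℝ)..T, f (σ + T * Complex.I)
      = G (T + T * Complex.I) - G ((0 : ℝ) + T * Complex.I) := by
    refine intervalIntegral.integral_eq_sub_of_hasDerivAt
      (f := fun σ : ℝ => G (σ + T * Complex.I)) (fun σ hσ => ?_)
      (intervalIntegrable_top hT hf)
    rw [Set.uIcc_of_le hT] at hσ
    simpa [Function.comp_def] using (hG _ (top_mem_halfSquare hσ)).comp σ (hh (T * Complex.I) σ)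
  have hr : ∫ t in (-T)..T, Complex.I * f (T + t * Complex.I)
      = G (T + T * Complex.I) - G (T + (-T : ℝ) * Complex.I) := by
    refine intervalIntegral.integral_eq_sub_of_hasDerivAt
      (f := fun t : ℝ => G (T + t * Complex.I)) (fun t ht => ?_)
      ((intervalIntegrable_right hT hf).const_mul _)
    rw [Set.uIcc_of_le (by linarith)] at ht
    simpa [Function.comp_def, mul_comm] using (hG _ (right_mem_halfSquare ht)).comp t (hv T t)
  rw [intervalIntegral.integral_const_mul] at hr
  unfold halfSquareIntegral
  rw [hb, hr, ht]
  simp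

theorem squareIntegral_eq_zero_of_hasDerivAt {f G : ℂ → ℂ} {T : ℝ} (hT : 0 ≤ T)
    (hf : SquareContinuous f T)
    (hG : ∀ s ∈ halfSquare T, HasDerivAt G (f s) s ∧ HasDerivAt G (f (-s)) (-s)) :
    squareIntegral f T = 0 := by
  unfold squareIntegral
  rw [halfSquareIntegral_eq_sub hT hf.1 fun s hs => (hG s hs).1,
    halfSquareIntegral_eq_sub (G := fun s => -G (-s)) hT hf.2 fun s hs => ?_]
  · simp only [neg_neg]
    ring
  · have := ((hG s hs).2.comp s (hasDerivAt_neg s)).fun_neg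
    simpa [Function.comp_def] using this

theorem squareIntegral_zpow {e : ℤ} (he : e ≠ -1) {T : ℝ} (hT : 0 < T) :
    squareIntegral (fun s => s ^ e) T = 0 := by
  have hne := fun s (hs : s ∈ halfSquare T) => ne_zero_of_mem_halfSquare hT hs
  have he' : (e : ℂ) + 1 ≠ 0 := by
    intro h
    apply he
    have : (e : ℂ) = ((-1 : ℤ) : ℂ) := by
      push_cast
      linear_combination h
    exact_mod_cast this
  have key : ∀ s : ℂ, s ≠ 0 → HasDerivAt (fun s : ℂ => s ^ (e + 1) / ((e : ℂ) + 1)) (s ^ e) s := by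
    intro s hs
    have := (hasDerivAt_zpow (e + 1) s (Or.inl hs)).div_const ((e : ℂ) + 1)
    rwa [add_sub_cancel_right, Int.cast_add, Int.cast_one, mul_div_cancel_left₀ _ he'] at this
  refine squareIntegral_eq_zero_of_hasDerivAt hT.le (squareContinuous_of_continuousAt fun s hs =>
    ⟨continuousAt_zpow₀ _ _ (Or.inl (hne s hs)),
      continuousAt_zpow₀ _ _ (Or.inl (neg_ne_zero.2 (hne s hs)))⟩) fun s hs => ⟨key s (hne s hs),
      key _ (neg_ne_zero.2 (hne s hs))⟩

/-- This makes the principal logarithm a primitive of `(s - iy)⁻¹` along the whole right half. The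
left half is reached through `s ↦ -s`, so no branch cut is ever crossed. -/
theorem sub_mul_I_mem_slitPlane {T y : ℝ} (hy : |y| < T) {s : ℂ} (hs : s ∈ halfSquare T) :
    s - y * Complex.I ∈ Complex.slitPlane := by
  rw [Complex.mem_slitPlane_iff]
  rcases hs.2.2.2 with h | h
  · right
    simp only [Complex.sub_im, Complex.mul_im, Complex.ofReal_re, Complex.I_im, mul_one,
      Complex.ofReal_im, Complex.I_re, mul_zero, add_zero]
    intro h0
    rw [sub_eq_zero] at h0
    rw [h0] at h
    linarith
  · left
    simpa [h] using (abs_nonneg y).trans_lt hy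

theorem halfSquareIntegral_inv_sub {T y : ℝ} (hy : |y| < T) :
    halfSquareIntegral (fun s => (s - y * Complex.I)⁻¹) T
      = Real.log (T - y) - Real.log (T + y) + Real.pi * Complex.I := by
  have hT : 0 < T := (abs_nonneg y).trans_lt hy
  have hy' := abs_lt.1 hy
  rw [halfSquareIntegral_eq_sub (G := fun s => Complex.log (s - y * Complex.I)) hT.le]
  · have h1 : (T : ℂ) * Complex.I - y * Complex.I = (T - y : ℝ) * Complex.I := by
      push_cast; ring
    have h2 : -((T : ℂ) * Complex.I) - y * Complex.I = (T + y : ℝ) * (-Complex.I) := by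
      push_cast; ring
    simp only [h1, h2]
    rw [Complex.log_ofReal_mul (by linarith) Complex.I_ne_zero,
      Complex.log_ofReal_mul (by linarith) (neg_ne_zero.2 Complex.I_ne_zero), Complex.log_I,
      Complex.log_neg_I]
    ring
  · intro s hs
    refine ContinuousAt.continuousWithinAt (ContinuousAt.inv₀ (by fun_prop) ?_)
    exact Complex.slitPlane_ne_zero (sub_mul_I_mem_slitPlane hy hs)
  · intro s hs
    simpa using ((hasDerivAt_id s).sub_const (y * Complex.I)).clog (sub_mul_I_mem_slitPlane hy hs)

theorem squareIntegral_inv_sub {T y : ℝ} (hy : |y| < T) :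
    squareIntegral (fun s => (s - y * Complex.I)⁻¹) T = 2 * Real.pi * Complex.I := by
  have h : (fun s : ℂ => (-s - y * Complex.I)⁻¹)
      = fun s => (-1) * (s - (-y : ℝ) * Complex.I)⁻¹ := by
    funext s
    rw [neg_one_mul, ← inv_neg]
    congr 1
    push_cast
    ring
  unfold squareIntegral
  rw [h, halfSquareIntegral_const_mul, halfSquareIntegral_inv_sub hy,
    halfSquareIntegral_inv_sub (by rwa [abs_neg])]
  simp only [sub_neg_eq_add, ← sub_eq_add_neg]
  ring

theorem squareContinuous_inv_sub {T y : ℝ} (hy : |y| < T) :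
    SquareContinuous (fun s => (s - y * Complex.I)⁻¹) T := by
  refine squareContinuous_of_continuousAt fun s hs => ⟨?_, ?_⟩
  · exact ContinuousAt.inv₀ (by fun_prop)
      (Complex.slitPlane_ne_zero (sub_mul_I_mem_slitPlane hy hs))
  · refine ContinuousAt.inv₀ (by fun_prop) fun h => ?_
    refine Complex.slitPlane_ne_zero (sub_mul_I_mem_slitPlane (y := -y) (by rwa [abs_neg]) hs) ?_
    push_cast
    linear_combination -h

/-- Cauchy's theorem on `[0, T] × [-T, T]` moves the right half onto the imaginary axis, for `f` and
for `f(-s)` alike; there the two integrals agree by `t ↦ -t`. -/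
theorem squareIntegral_of_differentiableOn {f : ℂ → ℂ} {T : ℝ}
    (hf : DifferentiableOn ℂ f {s | |s.im| ≤ T}) (hT : 0 ≤ T) : squareIntegral f T = 0 := by
  have key : ∀ g : ℂ → ℂ, DifferentiableOn ℂ g {s | |s.im| ≤ T} →
      halfSquareIntegral g T = Complex.I * ∫ t in (-T)..T, g (t * Complex.I) := by
    intro g hg
    have := Complex.integral_boundary_rect_eq_zero_of_differentiableOn g (⟨0, -T⟩ : ℂ) ⟨T, T⟩
      (hg.mono fun s hs => by
        have h2 := (Complex.mem_reProdIm.1 hs).2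
        rw [Set.uIcc_of_le (by simpa using (by linarith : -T ≤ T))] at h2
        exact abs_le.2 h2)
    simp only [smul_eq_mul, Complex.ofReal_zero, zero_add] at this
    unfold halfSquareIntegral
    linear_combination this
  unfold squareIntegral
  rw [key f hf, key (fun s => f (-s)) (hf.comp (by fun_prop) fun s hs => by simpa using hs)]
  have := intervalIntegral.integral_comp_neg (a := -T) (b := T) fun t : ℝ => f (t * Complex.I)
  simp only [Complex.ofReal_neg, neg_neg, neg_mul] at this
  rw [this, sub_self]

/-- Removable singularities in the strip do not contribute. -/
theorem squareIntegral_of_removable {f : ℂ → ℂ} {T : ℝ} (hT : 0 ≤ T)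
    (hf : ∀ z : ℂ, |z.im| ≤ T → ∃ h : ℂ → ℂ, AnalyticAt ℂ h z ∧ f =ᶠ[𝓝[≠] z] h)
    (hc : ∀ s ∈ halfSquare T, ContinuousAt f s ∧ ContinuousAt f (-s)) :
    squareIntegral f T = 0 := by
  set E : ℂ → ℂ := fun z => limUnder (𝓝[≠] z) f with hE
  have hlim : ∀ (z : ℂ) (h : ℂ → ℂ), ContinuousAt h z → f =ᶠ[𝓝[≠] z] h → E z = h z := by
    intro z h hh hfh
    exact Tendsto.limUnder_eq ((hh.tendsto.mono_left nhdsWithin_le_nhds).congr' hfh.symm)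
  rw [squareIntegral_congr hT (g := E) fun s hs => ⟨(hlim s f (hc s hs).1 .rfl).symm,
    (hlim _ f (hc s hs).2 .rfl).symm⟩]
  refine squareIntegral_of_differentiableOn (fun z hz => ?_) hT
  obtain ⟨h, hh, hfh⟩ := hf z hz
  have heq : E =ᶠ[𝓝 z] h := by
    have h1 : ∀ᶠ w in 𝓝[≠] z, E w = h w := by
      -- At `w ≠ z` close to `z`, `f` agrees with `h` on a full neighbourhood of `w`, so the limit
      -- defining `E w` is `h w`.
      have h2 : ∀ᶠ w in 𝓝[≠] z, ∀ᶠ v in 𝓝 w, f v = h v :=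
        eventually_nhdsNE_eventually_nhds_iff.2 hfh
      filter_upwards [h2, nhdsWithin_le_nhds hh.eventually_continuousAt] with w hw hcw
      exact hlim w h hcw (nhdsWithin_le_nhds hw)
    have h0 : E z = h z := hlim z h hh.continuousAt hfh
    filter_upwards [insert_mem_nhds_iff.2 h1] with w hw
    rcases hw with rfl | hw
    exacts [h0, hw]
  exact (hh.differentiableAt.congr_of_eventuallyEq heq).differentiableWithinAt

/-! ### The kernel in exponential form and its principal parts -/

variable {n : ℕ}

/-- The kernel written with exponentials: `L k = log aₖ` and `u = log x`. -/
def expKernel (L : Fin n → ℝ) (u : ℝ) (s : ℂ) : ℂ :=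
  Complex.exp (u * s) / (s * ∏ k, (1 - Complex.exp (-(L k * s))))

/-- The zero `2πik / l` of `1 - exp (-l s)`. -/
def pole (l : ℝ) (k : ℤ) : ℂ :=
  (2 * Real.pi * k / l : ℝ) * Complex.I

theorem pole_re (l : ℝ) (k : ℤ) : (pole l k).re = 0 := by
  simp [pole, -Complex.ofReal_div, -Complex.ofReal_mul]

theorem pole_im (l : ℝ) (k : ℤ) : (pole l k).im = 2 * Real.pi * k / l := by
  simp [pole, -Complex.ofReal_div, -Complex.ofReal_mul]

theorem pole_ne_zero {l : ℝ} (hl : 0 < l) {k : ℤ} (hk : k ≠ 0) : pole l k ≠ 0 := by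
  intro h
  have := congrArg Complex.im h
  rw [pole_im, Complex.zero_im, div_eq_zero_iff] at this
  rcases this with h | h
  · simp [Real.pi_ne_zero, hk] at h
  · exact hl.ne' h

theorem one_sub_exp_eq_zero_iff {l : ℝ} (hl : 0 < l) {s : ℂ} :
    1 - Complex.exp (-(l * s)) = 0 ↔ ∃ k : ℤ, s = pole l k := by
  have hl' : (l : ℂ) ≠ 0 := by exact_mod_cast hl.ne'
  rw [sub_eq_zero, eq_comm, Complex.exp_eq_one_iff]
  constructor
  · rintro ⟨k, hk⟩
    refine ⟨-k, ?_⟩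
    unfold pole
    push_cast
    field_simp
    linear_combination -hk
  · rintro ⟨k, rfl⟩
    refine ⟨-k, ?_⟩
    unfold pole
    push_cast
    field_simp

/-- The side `T = 2πR` is chosen for this: the pole of index `k` is inside exactly when `|k| < R l`,
which is the truncation at `⌊R log aₘ⌋`. -/
theorem pole_im_lt_iff {l R : ℝ} (hl : 0 < l) {k : ℤ} :
    |(pole l k).im| < 2 * Real.pi * R ↔ |(k : ℝ)| < R * l := by
  have hpi := Real.pi_pos
  rw [pole_im, abs_div, abs_mul, abs_of_pos hl, abs_of_pos (by positivity : 0 < 2 * Real.pi),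
    div_lt_iff₀ hl, mul_assoc _ R, mul_lt_mul_iff_right₀ (by positivity)]

theorem pole_im_le_iff {l R : ℝ} (hl : 0 < l) {k : ℤ} :
    |(pole l k).im| ≤ 2 * Real.pi * R ↔ |(k : ℝ)| ≤ R * l := by
  have hpi := Real.pi_pos
  rw [pole_im, abs_div, abs_mul, abs_of_pos hl, abs_of_pos (by positivity : 0 < 2 * Real.pi),
    div_le_iff₀ hl, mul_assoc _ R, mul_le_mul_iff_right₀ (by positivity)]

theorem pole_eq_pole_iff {l l' : ℝ} (hl : 0 < l) (hl' : 0 < l') {k k' : ℤ} :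
    pole l k = pole l' k' ↔ (k : ℝ) * l' = k' * l := by
  have hpi := Real.pi_pos
  rw [Complex.ext_iff, pole_re, pole_re, pole_im, pole_im, div_eq_div_iff hl.ne' hl'.ne']
  constructor
  · rintro ⟨-, h⟩
    have : 2 * Real.pi * (k * l') = 2 * Real.pi * (k' * l) := by linear_combination h
    exact mul_left_cancel₀ (by positivity) this
  · intro h
    exact ⟨rfl, by linear_combination 2 * Real.pi * h⟩

theorem analyticAt_dslope {f : ℂ → ℂ} {p : ℂ} (hf : AnalyticAt ℂ f p) :
    AnalyticAt ℂ (dslope f p) p := by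
  obtain ⟨q, hq⟩ := hf
  exact hq.has_fpower_series_dslope_fslope.analyticAt

theorem eq_add_sub_mul_dslope (f : ℂ → ℂ) (p s : ℂ) : f s = f p + (s - p) * dslope f p s := by
  rw [← smul_eq_mul, sub_smul_dslope]
  ring

theorem analyticAt_one_sub_exp (l : ℝ) (z : ℂ) :
    AnalyticAt ℂ (fun s : ℂ => 1 - Complex.exp (-(l * s))) z := by
  fun_prop

theorem exists_one_sub_exp_eq_mul (l : ℝ) {p : ℂ} (hp : 1 - Complex.exp (-(l * p)) = 0) :
    ∃ U : ℂ → ℂ, AnalyticAt ℂ U p ∧ U p = l ∧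
      ∀ s, 1 - Complex.exp (-(l * s)) = (s - p) * U s := by
  refine ⟨dslope (fun s : ℂ => 1 - Complex.exp (-(l * s))) p,
    analyticAt_dslope (analyticAt_one_sub_exp l p), ?_, fun s => ?_⟩
  · rw [dslope_same]
    have h1 : HasDerivAt (fun s : ℂ => 1 - Complex.exp (-(l * s)))
        (-(Complex.exp (-(l * p)) * (-(l * 1)))) p :=
      ((((hasDerivAt_id p).const_mul (l : ℂ)).fun_neg).cexp).const_sub 1
    rw [h1.deriv, ← sub_eq_zero.1 hp]
    ring
  · have := eq_add_sub_mul_dslope (fun s : ℂ => 1 - Complex.exp (-(l * s))) p s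
    rwa [hp, zero_add] at this

theorem analyticAt_expKernel {L : Fin n → ℝ} {u : ℝ} {z : ℂ} (hz : z ≠ 0)
    (hz' : ∀ m, 1 - Complex.exp (-(L m * z)) ≠ 0) : AnalyticAt ℂ (expKernel L u) z := by
  unfold expKernel
  refine AnalyticAt.fun_div (by fun_prop) (analyticAt_id.fun_mul ?_)
    (mul_ne_zero hz (Finset.prod_ne_zero_iff.2 fun m _ => hz' m))
  exact Finset.analyticAt_fun_prod _ fun m _ => analyticAt_one_sub_exp _ _

/-- Each of the `n` factors is `s U(s)` with `U(0) = L m ≠ 0`, and there is one more factor `s`.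
Taylor expansion of `e^{us} / ∏ U` to order `n + 1` gives the principal part. -/
theorem exists_principalPart_zero {L : Fin n → ℝ} (hL : ∀ m, 0 < L m) (u : ℝ) :
    ∃ (c : ℕ → ℂ) (h : ℂ → ℂ), AnalyticAt ℂ h 0 ∧ ∀ s, s ≠ 0 →
      expKernel L u s
        = (∑ j ∈ Finset.range (n + 1), c j * s ^ ((j : ℤ) - ((n + 1 : ℕ) : ℤ))) + h s := by
  choose U hUa hU0 hU using fun m => exists_one_sub_exp_eq_mul (L m) (p := 0) (by simp)
  have hW : AnalyticAt ℂ (fun s => Complex.exp (u * s) / ∏ m, U m s) 0 := by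
    refine AnalyticAt.fun_div (by fun_prop) (Finset.analyticAt_fun_prod _ fun m _ => hUa m)
      (Finset.prod_ne_zero_iff.2 fun m _ => ?_)
    rw [hU0]
    exact_mod_cast (hL m).ne'
  obtain ⟨h, hh, hexp⟩ := hW.exists_eq_sum_add_pow_mul (n + 1)
  refine ⟨fun j => iteratedDeriv j (fun s => Complex.exp (u * s) / ∏ m, U m s) 0 / j.factorial,
    h, hh, fun s hs => ?_⟩
  have h1 : expKernel L u s = Complex.exp (u * s) / (∏ m, U m s) / s ^ (n + 1) := by
    unfold expKernel
    simp only [hU, sub_zero, Finset.prod_mul_distrib, Finset.prod_const, Finset.card_univ,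
      Fintype.card_fin]
    rw [div_div]
    congr 1
    ring
  have hs' : s ^ (n + 1) ≠ 0 := pow_ne_zero _ hs
  rw [h1, hexp s, add_div, smul_eq_mul, mul_div_cancel_left₀ _ hs', Finset.sum_div]
  congr 1
  refine Finset.sum_congr rfl fun j _ => ?_
  rw [zpow_sub₀ hs, zpow_natCast, zpow_natCast, smul_eq_mul]
  ring

/-- Only the index `j = n` carries the exponent `-1`; all other powers and the analytic part
integrate to zero. -/
theorem residue_of_principalPart {f h : ℂ → ℂ} {c : ℕ → ℂ} (hh : AnalyticAt ℂ h 0)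
    (hf : ∀ s, s ≠ 0 → f s
      = (∑ j ∈ Finset.range (n + 1), c j * s ^ ((j : ℤ) - ((n + 1 : ℕ) : ℤ))) + h s) :
    residue f 0 = c n := by
  obtain ⟨r, hr, hball⟩ := Metric.eventually_nhds_iff_ball.1 hh.eventually_analyticAt
  refine Tendsto.limUnder_eq (tendsto_const_nhds.congr' ?_)
  filter_upwards [Ioo_mem_nhdsGT hr] with ρ hρ
  have hsub : Metric.closedBall (0 : ℂ) ρ ⊆ Metric.ball 0 r :=
    Metric.closedBall_subset_ball hρ.2
  have hci : ∀ j, CircleIntegrable (fun s : ℂ => c j * s ^ ((j : ℤ) - ((n + 1 : ℕ) : ℤ))) 0 ρ := by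
    intro j
    refine ContinuousOn.circleIntegrable hρ.1.le fun s hs => ContinuousAt.continuousWithinAt ?_
    have : s ≠ 0 := ne_zero_of_mem_sphere hρ.1.ne' ⟨s, hs⟩
    exact continuousAt_const.mul (continuousAt_zpow₀ _ _ (Or.inl this))
  have hhc : CircleIntegrable h 0 ρ := ContinuousOn.circleIntegrable hρ.1.le fun s hs =>
    (hball s (hsub (Metric.sphere_subset_closedBall hs))).continuousAt.continuousWithinAt
  have hcong : (∮ z in C(0, ρ), f z)
      = ∮ z in C(0, ρ), ((∑ j ∈ Finset.range (n + 1), c j * z ^ ((j : ℤ) - ((n + 1 : ℕ) : ℤ)))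
        + h z) := by
    refine circleIntegral.integral_congr hρ.1.le fun s hs => ?_
    exact hf s (ne_zero_of_mem_sphere hρ.1.ne' ⟨s, hs⟩)
  have hzero : (∮ z in C(0, ρ), h z) = 0 := by
    refine Complex.circleIntegral_eq_zero_of_differentiable_on_off_countable hρ.1.le
      Set.countable_empty (fun s hs => (hball s (hsub hs)).continuousAt.continuousWithinAt)
      fun s hs => (hball s (hsub (Metric.ball_subset_closedBall hs.1))).differentiableAt
  have hpow : ∀ j ∈ Finset.range (n + 1), j ≠ n →
      (∮ z in C(0, ρ), c j * z ^ ((j : ℤ) - ((n + 1 : ℕ) : ℤ))) = 0 := by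
    intro j hj hjn
    rw [circleIntegral.integral_const_mul]
    have := circleIntegral.integral_sub_zpow_of_ne (n := (j : ℤ) - ((n + 1 : ℕ) : ℤ))
      (by push_cast; omega) 0 0 ρ
    simp only [sub_zero] at this
    rw [this, mul_zero]
  have hinv : (∮ z in C(0, ρ), c n * z ^ ((n : ℤ) - ((n + 1 : ℕ) : ℤ)))
      = c n * (2 * Real.pi * Complex.I) := by
    rw [circleIntegral.integral_const_mul]
    have := circleIntegral.integral_sub_inv_of_mem_ball (Metric.mem_ball_self hρ.1 (x := (0 : ℂ)))
    simp only [sub_zero] at this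
    rw [← this]
    simp
  rw [hcong, circleIntegral.integral_add (CircleIntegrable.fun_sum _ fun j _ => hci j) hhc, hzero,
    circleIntegral.integral_fun_sum fun j _ => hci j, Finset.sum_eq_single n hpow (by simp), hinv]
  have : (2 * (Real.pi : ℂ) * Complex.I) ≠ 0 := Complex.two_pi_I_ne_zero
  field_simp
  simp

/-- The residue of the kernel at a simple pole `2πik / L m`. -/
def simpleResidue (L : Fin n → ℝ) (u : ℝ) (m : Fin n) (k : ℤ) : ℂ :=
  Complex.exp (u * pole (L m) k) / (pole (L m) k * L m *
    ∏ l ∈ Finset.univ.erase m, (1 - Complex.exp (-(L l * pole (L m) k))))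

/-- No two of the numbers `L m` are commensurable. -/
def Incommensurable (L : Fin n → ℝ) : Prop :=
  ∀ m l, m ≠ l → ∀ i j : ℤ, i ≠ 0 → (i : ℝ) * L l ≠ j * L m

/-- A second factor vanishing at this point would give an integer relation between `L m` and `L l`,
so the pole is simple. -/
theorem exists_principalPart_pole {L : Fin n → ℝ} (hL : ∀ m, 0 < L m) (hi : Incommensurable L)
    (u : ℝ) (m : Fin n) {k : ℤ} (hk : k ≠ 0) :
    ∃ h : ℂ → ℂ, AnalyticAt ℂ h (pole (L m) k) ∧ ∀ s, s ≠ pole (L m) k →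
      expKernel L u s = simpleResidue L u m k * (s - pole (L m) k)⁻¹ + h s := by
  set p := pole (L m) k with hp
  have hp0 : p ≠ 0 := pole_ne_zero (hL m) hk
  obtain ⟨U, hUa, hUp, hU⟩ :=
    exists_one_sub_exp_eq_mul (L m) ((one_sub_exp_eq_zero_iff (hL m)).2 ⟨k, hp⟩)
  have hLm : (L m : ℂ) ≠ 0 := by exact_mod_cast (hL m).ne'
  have hl : ∀ l ∈ Finset.univ.erase m, 1 - Complex.exp (-(L l * p)) ≠ 0 := by
    intro l hlm h
    obtain ⟨j, hj⟩ := (one_sub_exp_eq_zero_iff (hL l)).1 h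
    rw [hp, pole_eq_pole_iff (hL m) (hL l)] at hj
    exact hi m l (Finset.ne_of_mem_erase hlm).symm k j hk hj
  set w : ℂ → ℂ := fun s => Complex.exp (u * s) / (s * U s *
    ∏ l ∈ Finset.univ.erase m, (1 - Complex.exp (-(L l * s)))) with hw
  have hwa : AnalyticAt ℂ w p := by
    refine AnalyticAt.fun_div (by fun_prop) ((analyticAt_id.fun_mul hUa).fun_mul
      (Finset.analyticAt_fun_prod _ fun l _ => analyticAt_one_sub_exp _ _)) ?_
    exact mul_ne_zero (mul_ne_zero hp0 (hUp ▸ hLm)) (Finset.prod_ne_zero_iff.2 hl)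
  refine ⟨dslope w p, analyticAt_dslope hwa, fun s hs => ?_⟩
  have hsp : s - p ≠ 0 := sub_ne_zero.2 hs
  have h1 : expKernel L u s = w s * (s - p)⁻¹ := by
    rw [hw]
    unfold expKernel
    rw [← Finset.mul_prod_erase _ _ (Finset.mem_univ m), hU s, ← div_eq_mul_inv, div_div]
    congr 1
    ring
  have h2 : w p = simpleResidue L u m k := by
    simp only [hw, hUp, simpleResidue, ← hp]
  rw [h1, eq_add_sub_mul_dslope w p s, h2]
  field_simp

/-! ### The sum of the residues in a square -/

/-- The indices `(m, k)` of the nonzero poles `2πik / L m` with `|k| ≤ R L m`. -/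
def poleIndices (L : Fin n → ℝ) (R : ℝ) : Finset (Σ _ : Fin n, ℤ) :=
  Finset.univ.sigma fun m =>
    (Finset.Icc (-(⌊R * L m⌋₊ : ℤ)) (⌊R * L m⌋₊ : ℤ)).erase 0

theorem mem_poleIndices {L : Fin n → ℝ} (hL : ∀ m, 0 < L m) {R : ℝ} (hR : 0 < R) {m : Fin n}
    {k : ℤ} : (⟨m, k⟩ : Σ _ : Fin n, ℤ) ∈ poleIndices L R ↔ k ≠ 0 ∧ |(k : ℝ)| ≤ R * L m := by
  have hRL : 0 ≤ R * L m := (mul_pos hR (hL m)).le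
  have : |(k : ℝ)| ≤ R * L m ↔ -(⌊R * L m⌋₊ : ℤ) ≤ k ∧ k ≤ (⌊R * L m⌋₊ : ℤ) := by
    rw [← abs_le, ← Int.natCast_natAbs, Int.ofNat_le,
      Nat.le_floor_iff hRL, Nat.cast_natAbs, Int.cast_abs]
  simp [poleIndices, this]

/-- After all principal parts are subtracted, only removable singularities are left in the strip,
and the principal parts are integrated explicitly. -/
theorem squareIntegral_expKernel {L : Fin n → ℝ} (hL : ∀ m, 0 < L m) (hi : Incommensurable L)
    (u : ℝ) {R δ : ℝ} (hR : 0 < R) (hδ : 0 < δ) (hadm : ∀ m, ∀ k : ℤ, δ ≤ |R * L m - k|) :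
    squareIntegral (expKernel L u) (2 * Real.pi * R) = 2 * Real.pi * Complex.I *
      (residue (expKernel L u) 0
        + ∑ i ∈ poleIndices L R, simpleResidue L u i.1 i.2) := by
  obtain ⟨c, h₀, hh₀, hF₀⟩ := exists_principalPart_zero hL u
  rw [residue_of_principalPart hh₀ hF₀]
  have hT : 0 < 2 * Real.pi * R := by positivity
  set T := 2 * Real.pi * R with hTdef
  have hlt : ∀ i ∈ poleIndices L R, |(pole (L i.1) i.2).im| < T := by
    rintro ⟨m, k⟩ hmk
    have hmk' := ((mem_poleIndices hL hR).1 hmk).2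
    rw [hTdef, pole_im_lt_iff (hL m)]
    refine lt_of_le_of_ne hmk' fun heq => ?_
    -- A pole on the boundary would have `|k| = R L m`, which is at distance `0` from an integer.
    have h1 := hadm m |k|
    rw [Int.cast_abs, heq, sub_self, abs_zero] at h1
    linarith
  have hpoleI : ∀ i : (Σ _ : Fin n, ℤ),
      pole (L i.1) i.2 = ((pole (L i.1) i.2).im : ℂ) * Complex.I := by
    intro i
    rw [pole_im, pole]
  have hmem : ∀ m k, pole (L m) k ≠ 0 → |(pole (L m) k).im| ≤ T →
      (⟨m, k⟩ : Σ _ : Fin n, ℤ) ∈ poleIndices L R := by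
    intro m k h0 hle
    rw [mem_poleIndices hL hR]
    refine ⟨fun hk => h0 ?_, (pole_im_le_iff (hL m)).1 hle⟩
    simp [hk, pole]
  have hnotmem : ∀ z : ℂ, z ≠ 0 → |z.im| ≤ T →
      (∀ i ∈ poleIndices L R, z ≠ pole (L i.1) i.2) → AnalyticAt ℂ (expKernel L u) z := by
    intro z hz hzT hzp
    refine analyticAt_expKernel hz fun m hm => ?_
    obtain ⟨k, hk⟩ := (one_sub_exp_eq_zero_iff (hL m)).1 hm
    exact hzp ⟨m, k⟩ (hmem m k (hk ▸ hz) (hk ▸ hzT)) hk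
  have hsq : ∀ s ∈ halfSquare T, ∀ i ∈ poleIndices L R,
      s ≠ pole (L i.1) i.2 ∧ -s ≠ pole (L i.1) i.2 := by
    intro s hs i hip
    have key : ∀ z : ℂ, (|z.im| = T ∨ |z.re| = T) → z ≠ pole (L i.1) i.2 := by
      rintro z hz rfl
      rcases hz with h | h
      · exact (hlt i hip).ne h
      · rw [pole_re, abs_zero] at h
        exact hT.ne h
    have hs' : |s.im| = T ∨ |s.re| = T :=
      hs.2.2.2.imp id fun h => by rw [h, abs_of_pos hT]
    exact ⟨key s hs', key (-s) (by simpa using hs')⟩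
  set Q₀ : ℂ → ℂ := fun s => ∑ j ∈ Finset.range (n + 1), c j * s ^ ((j : ℤ) - ((n + 1 : ℕ) : ℤ))
    with hQ₀
  set q : (Σ _ : Fin n, ℤ) → ℂ → ℂ := fun i s =>
    simpleResidue L u i.1 i.2 * (s - pole (L i.1) i.2)⁻¹ with hq
  have hQ₀a : ∀ z, z ≠ 0 → AnalyticAt ℂ Q₀ z := fun z hz =>
    Finset.analyticAt_fun_sum _ fun j _ => analyticAt_const.fun_mul (analyticAt_id.fun_zpow hz)
  have hqa : ∀ i z, z ≠ pole (L i.1) i.2 → AnalyticAt ℂ (q i) z := fun i z hz =>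
    analyticAt_const.fun_mul ((analyticAt_id.fun_sub analyticAt_const).fun_inv (sub_ne_zero.2 hz))
  set D : ℂ → ℂ := fun s => expKernel L u s - Q₀ s - ∑ i ∈ poleIndices L R, q i s with hD
  have hDa : ∀ z, z ≠ 0 → |z.im| ≤ T → (∀ i ∈ poleIndices L R, z ≠ pole (L i.1) i.2) →
      AnalyticAt ℂ D z := by
    intro z hz hzT hzp
    exact ((hnotmem z hz hzT hzp).fun_sub (hQ₀a z hz)).fun_sub
      (Finset.analyticAt_fun_sum _ fun i hip => hqa i z (hzp i hip))
  have hneg : ∀ s ∈ halfSquare T, -s ≠ 0 := fun s hs =>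
    neg_ne_zero.2 (ne_zero_of_mem_halfSquare hT hs)
  have hD0 : squareIntegral D T = 0 := by
    refine squareIntegral_of_removable hT.le (fun z hz => ?_) fun s hs => ⟨?_, ?_⟩
    · by_cases h0 : z = 0
      · subst h0
        refine ⟨fun s => h₀ s - ∑ i ∈ poleIndices L R, q i s, hh₀.fun_sub
          (Finset.analyticAt_fun_sum _ fun i hip => hqa i 0 ?_), ?_⟩
        · exact (pole_ne_zero (hL i.1) ((mem_poleIndices hL hR).1 hip).1).symm
        · filter_upwards [self_mem_nhdsWithin] with s hs
          simp only [hD, hF₀ s hs, hQ₀]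
          ring
      by_cases hp : ∃ i ∈ poleIndices L R, z = pole (L i.1) i.2
      · obtain ⟨i, hip, rfl⟩ := hp
        obtain ⟨h, hh, hF⟩ := exists_principalPart_pole hL hi u i.1
          ((mem_poleIndices hL hR).1 hip).1
        refine ⟨fun s => h s - Q₀ s - ∑ j ∈ (poleIndices L R).erase i, q j s,
          (hh.fun_sub (hQ₀a _ h0)).fun_sub (Finset.analyticAt_fun_sum _ fun j hj =>
            hqa j _ fun heq => ?_), ?_⟩
        · rw [Finset.mem_erase] at hj
          rw [pole_eq_pole_iff (hL _) (hL _)] at heq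
          obtain ⟨m, k⟩ := i
          obtain ⟨m', k'⟩ := j
          by_cases hmm : m = m'
          · subst hmm
            have : k = k' := by exact_mod_cast mul_right_cancel₀ (hL m).ne' heq
            exact hj.1 (by rw [this])
          · exact hi m m' hmm k k' ((mem_poleIndices hL hR).1 hip).1 heq
        · filter_upwards [self_mem_nhdsWithin] with s hs
          simp only [hD, hF s hs, ← Finset.add_sum_erase _ _ hip, hq]
          ring
      · push Not at hp
        exact ⟨D, hDa z h0 hz hp, .rfl⟩
    · exact (hDa s (ne_zero_of_mem_halfSquare hT hs) hs.2.2.1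
        fun i hip => (hsq s hs i hip).1).continuousAt
    · exact (hDa (-s) (hneg s hs) (by simpa using hs.2.2.1)
        fun i hip => (hsq s hs i hip).2).continuousAt
  have hDc : SquareContinuous D T := squareContinuous_of_continuousAt fun s hs =>
    ⟨(hDa s (ne_zero_of_mem_halfSquare hT hs) hs.2.2.1
        fun i hip => (hsq s hs i hip).1).continuousAt,
      (hDa (-s) (hneg s hs) (by simpa using hs.2.2.1)
        fun i hip => (hsq s hs i hip).2).continuousAt⟩
  have hQ₀c : SquareContinuous Q₀ T := squareContinuous_of_continuousAt fun s hs =>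
    ⟨(hQ₀a s (ne_zero_of_mem_halfSquare hT hs)).continuousAt, (hQ₀a _ (hneg s hs)).continuousAt⟩
  have hqc : ∀ i ∈ poleIndices L R, SquareContinuous (q i) T := fun i hip =>
    squareContinuous_of_continuousAt fun s hs =>
      ⟨(hqa i s (hsq s hs i hip).1).continuousAt, (hqa i _ (hsq s hs i hip).2).continuousAt⟩
  have hqsc : SquareContinuous (fun s => ∑ i ∈ poleIndices L R, q i s) T :=
    squareContinuous_of_continuousAt fun s hs =>
      ⟨(Finset.analyticAt_fun_sum _ fun i hip => hqa i s (hsq s hs i hip).1).continuousAt,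
        (Finset.analyticAt_fun_sum _ fun i hip => hqa i _ (hsq s hs i hip).2).continuousAt⟩
  have hsplit : squareIntegral (expKernel L u) T = squareIntegral D T + (squareIntegral Q₀ T
      + squareIntegral (fun s => ∑ i ∈ poleIndices L R, q i s) T) := by
    rw [← squareIntegral_add hT.le hQ₀c hqsc, ← squareIntegral_add hT.le hDc
      (f := D) (g := fun s => Q₀ s + ∑ i ∈ poleIndices L R, q i s)
      ⟨hQ₀c.1.add hqsc.1, hQ₀c.2.add hqsc.2⟩]
    congr 1
    funext s
    simp only [hD]
    ring
  have hJQ₀ : squareIntegral Q₀ T = c n * (2 * Real.pi * Complex.I) := by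
    have hc1 : ∀ j ∈ Finset.range (n + 1),
        SquareContinuous (fun s : ℂ => c j * s ^ ((j : ℤ) - ((n + 1 : ℕ) : ℤ))) T := fun j _ =>
      squareContinuous_of_continuousAt fun s hs =>
        ⟨continuousAt_const.mul (continuousAt_zpow₀ _ _
            (Or.inl (ne_zero_of_mem_halfSquare hT hs))),
          continuousAt_const.mul (continuousAt_zpow₀ _ _ (Or.inl (hneg s hs)))⟩
    rw [hQ₀, squareIntegral_sum _ hT.le hc1, Finset.sum_eq_single n]
    · rw [squareIntegral_const_mul]
      have := squareIntegral_inv_sub (T := T) (y := 0) (by simpa using hT)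
      simp only [Complex.ofReal_zero, zero_mul, sub_zero] at this
      rw [← this]
      simp
    · intro j _ hjn
      rw [squareIntegral_const_mul, squareIntegral_zpow (by push_cast; omega) hT, mul_zero]
    · simp
  rw [hsplit, hD0, hJQ₀, squareIntegral_sum _ hT.le hqc, zero_add, mul_add, Finset.mul_sum]
  congr 1
  · ring
  · refine Finset.sum_congr rfl fun i hip => ?_
    simp only [hq]
    rw [squareIntegral_const_mul, hpoleI i, squareIntegral_inv_sub (hlt i hip)]
    ring

/-! ### Asymptotics of the integrals along the half squares -/

theorem tendsto_halfSquareIntegral_zero {f : ℂ → ℂ} {F : Filter ℝ} (hF : F ≤ atTop) {C c : ℝ}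
    (hC : 0 ≤ C) (hc : 0 < c)
    (h : ∀ᶠ R in F, ∀ s ∈ halfSquare (2 * Real.pi * R),
      ‖f s‖ ≤ C / (2 * Real.pi * R) * Real.exp (-c * s.re)) :
    Tendsto (fun R => halfSquareIntegral f (2 * Real.pi * R)) F (𝓝 0) := by
  have hlim : Tendsto (fun R : ℝ => 4 * C / c / (2 * Real.pi * R)) F (𝓝 0) :=
    (tendsto_const_nhds.div_atTop (tendsto_id.const_mul_atTop (by positivity))).mono_left hF
  refine squeeze_zero_norm' ?_ hlim
  filter_upwards [h, hF (eventually_gt_atTop 0)] with R hR hR0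
  exact norm_halfSquareIntegral_le (by positivity) hc hC hR

theorem norm_exp_mul_div_le {T v : ℝ} (hT : 0 < T) {s : ℂ} (hs : s ∈ halfSquare T) :
    ‖Complex.exp (v * s) / s‖ ≤ 1 / T * Real.exp (v * s.re) := by
  rw [norm_div, Complex.norm_exp, Complex.re_ofReal_mul, div_eq_mul_one_div, mul_comm]
  gcongr
  exact le_norm_of_mem_halfSquare hs

theorem squareContinuous_exp_mul_div (v : ℝ) {T : ℝ} (hT : 0 < T) :
    SquareContinuous (fun s => Complex.exp (v * s) / s) T := by
  refine squareContinuous_of_continuousAt fun s hs => ⟨?_, ?_⟩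
  · exact ContinuousAt.div (by fun_prop) continuousAt_id (ne_zero_of_mem_halfSquare hT hs)
  · exact ContinuousAt.div (by fun_prop) continuousAt_id
      (neg_ne_zero.2 (ne_zero_of_mem_halfSquare hT hs))

/-- The difference of `e^{vs} / s` and `1 / s` extends to an entire function. -/
theorem squareIntegral_exp_mul_div (v : ℝ) {T : ℝ} (hT : 0 < T) :
    squareIntegral (fun s => Complex.exp (v * s) / s) T = 2 * Real.pi * Complex.I := by
  set g : ℂ → ℂ := fun s => Complex.exp (v * s) with hg
  have hd : DifferentiableOn ℂ (dslope g 0) Set.univ :=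
    (Complex.differentiableOn_dslope univ_mem).2 (by fun_prop)
  have hinv := squareIntegral_inv_sub (T := T) (y := 0) (by simpa using hT)
  have hinvc := squareContinuous_inv_sub (T := T) (y := 0) (by simpa using hT)
  simp only [Complex.ofReal_zero, zero_mul, sub_zero] at hinv hinvc
  have key : ∀ s : ℂ, s ≠ 0 → g s / s = s⁻¹ + dslope g 0 s := by
    intro s hs
    have := eq_add_sub_mul_dslope g 0 s
    have h0 : g 0 = 1 := by simp [hg]
    rw [this, h0, sub_zero]
    field_simp
  rw [squareIntegral_congr hT.le (g := fun s => s⁻¹ + dslope g 0 s) fun s hs =>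
      ⟨key s (ne_zero_of_mem_halfSquare hT hs),
        key (-s) (neg_ne_zero.2 (ne_zero_of_mem_halfSquare hT hs))⟩,
    squareIntegral_add hT.le hinvc (squareContinuous_of_continuousAt fun s _ =>
      ⟨(hd.differentiableAt univ_mem).continuousAt,
        (hd.differentiableAt univ_mem).continuousAt⟩), hinv,
    squareIntegral_of_differentiableOn (hd.mono (Set.subset_univ _)) hT.le, add_zero]

/-- The step function with the value `1 / 2` at its jump. -/
def step (v : ℝ) : ℝ :=
  if v < 0 then 0 else if v = 0 then 1 / 2 else 1

/-- For `v < 0` the integrand decays to the right. For `v = 0` the path sees half a turn around `0`.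
For `v > 0` the full turn `2πi` remains after removing the left half, where the integrand decays. -/
theorem tendsto_halfSquareIntegral_exp_mul_div (v : ℝ) :
    Tendsto (fun R => halfSquareIntegral (fun s => Complex.exp (v * s) / s) (2 * Real.pi * R))
      atTop (𝓝 (2 * Real.pi * Complex.I * step v)) := by
  rcases lt_trichotomy v 0 with hv | rfl | hv
  · simp only [step, if_pos hv, Complex.ofReal_zero, mul_zero]
    refine tendsto_halfSquareIntegral_zero le_rfl zero_le_one (neg_pos.2 hv) ?_
    filter_upwards [eventually_gt_atTop 0] with R hR s hs
    simpa using norm_exp_mul_div_le (v := v) (by positivity) hs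
  · refine tendsto_const_nhds.congr' ?_
    filter_upwards [eventually_gt_atTop 0] with R hR
    have hT : 0 < 2 * Real.pi * R := by positivity
    have h1 := halfSquareIntegral_inv_sub (T := 2 * Real.pi * R) (y := 0) (by rwa [abs_zero])
    simp only [Complex.ofReal_zero, zero_mul, sub_zero, add_zero, sub_self, zero_add] at h1
    simp only [step, lt_irrefl, if_false, if_true, Complex.ofReal_zero, zero_mul, Complex.exp_zero,
      one_div]
    rw [h1]
    push_cast
    ring
  · simp only [step, if_neg hv.le.not_gt, if_neg hv.ne', Complex.ofReal_one, mul_one]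
    have h0 : Tendsto (fun R => halfSquareIntegral
        (fun s => Complex.exp (v * (-s)) / (-s)) (2 * Real.pi * R)) atTop (𝓝 0) := by
      refine tendsto_halfSquareIntegral_zero le_rfl zero_le_one hv ?_
      filter_upwards [eventually_gt_atTop 0] with R hR s hs
      simpa using norm_exp_mul_div_le (v := -v) (by positivity) hs
    have h1 := h0.const_add (2 * (Real.pi : ℂ) * Complex.I)
    rw [add_zero] at h1
    refine h1.congr' ?_
    filter_upwards [eventually_gt_atTop 0] with R hR
    have := squareIntegral_exp_mul_div v (T := 2 * Real.pi * R) (by positivity)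
    rw [← this, squareIntegral]
    ring

/-- The truncation parameters that stay away from all multiples of `1 / L m`. -/
def admissibleFor (L : Fin n → ℝ) (δ : ℝ) : Set ℝ :=
  {R | ∀ m, ∀ k : ℤ, δ ≤ |R * L m - k|}

/-- Subtract the nearest integer and apply Jordan's inequality `sin t ≥ 2t / π` on `[0, π/2]`. -/
theorem two_mul_le_abs_sin {y δ : ℝ} (h : ∀ k : ℤ, δ ≤ |y - k|) :
    2 * δ ≤ |Real.sin (Real.pi * y)| := by
  have hpi := Real.pi_pos
  have h1 : |y - round y| ≤ 1 / 2 := abs_sub_round y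
  have h2 : Real.sin (Real.pi * y) = Real.sin (Real.pi * (y - round y) + round y * Real.pi) := by
    congr 1; ring
  have h3 : |Real.sin (Real.pi * y)| = Real.sin (Real.pi * |y - round y|) := by
    rw [h2, Real.sin_add_int_mul_pi, abs_mul, abs_zpow, abs_neg, abs_one, one_zpow, one_mul,
      Real.abs_sin_eq_sin_abs_of_abs_le_pi, abs_mul, abs_of_pos hpi]
    rw [abs_mul, abs_of_pos hpi]
    nlinarith
  rw [h3]
  have h4 := Real.mul_le_sin (x := Real.pi * |y - round y|) (by positivity) (by nlinarith)
  have h5 : 2 / Real.pi * (Real.pi * |y - round y|) = 2 * |y - round y| := by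
    field_simp
  rw [h5] at h4
  linarith [h (round y)]

/-- Replacing `r w` by `w` costs `|r - 1|`, itself at most `‖1 - r w‖`. This reduces the horizontal
sides, where `|e^{-ls}|` varies, to the unit circle. -/
theorem norm_one_sub_le_two_mul {w : ℂ} {r : ℝ} (hw : ‖w‖ = 1) (hr : 0 ≤ r) :
    ‖1 - w‖ ≤ 2 * ‖1 - r * w‖ := by
  have h1 : ‖1 - w‖ ≤ ‖1 - r * w‖ + |r - 1| := by
    have : 1 - w = (1 - r * w) + ((r - 1 : ℝ) : ℂ) * w := by push_cast; ring
    rw [this]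
    refine (norm_add_le _ _).trans ?_
    rw [norm_mul, hw, mul_one, Complex.norm_real, Real.norm_eq_abs]
  have h2 : |r - 1| ≤ ‖1 - r * w‖ := by
    have := abs_norm_sub_norm_le (r * w) 1
    rwa [norm_mul, hw, mul_one, Complex.norm_real, Real.norm_of_nonneg hr, norm_one,
      norm_sub_rev] at this
  linarith

/-- A lower bound for `1 - exp (-l s)` on the half square. -/
def gap (δ l : ℝ) : ℝ :=
  min (2 * δ) (1 - Real.exp (-l))

theorem gap_pos {δ l : ℝ} (hδ : 0 < δ) (hl : 0 < l) : 0 < gap δ l :=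
  lt_min (by positivity) (by simpa using hl)

/-- On the horizontal sides the unit-circle value is `2 |sin (πRl)| ≥ 4δ`, and half of it survives.
On the vertical side `|e^{-ls}| = e^{-2πRl} ≤ e^{-l}`. -/
theorem gap_le_norm {δ l R : ℝ} (hl : 0 < l) (hR : 1 ≤ R) (h : ∀ k : ℤ, δ ≤ |R * l - k|) {s : ℂ}
    (hs : s ∈ halfSquare (2 * Real.pi * R)) : gap δ l ≤ ‖1 - Complex.exp (-(l * s))‖ := by
  have hpi := Real.pi_gt_three
  rcases hs.2.2.2 with him | hre
  · refine (min_le_left _ _).trans ?_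
    have hz : Complex.exp (-(l * s))
        = (Real.exp (-(l * s.re)) : ℂ) * Complex.exp (Complex.I * (-(l * s.im) : ℝ)) := by
      rw [Complex.ofReal_exp, ← Complex.exp_add]
      congr 1
      conv_lhs => rw [← Complex.re_add_im s]
      push_cast
      ring
    have hw : ‖Complex.exp (Complex.I * (-(l * s.im) : ℝ))‖ = 1 := Complex.norm_exp_I_mul_ofReal _
    have h1 := norm_one_sub_le_two_mul hw (Real.exp_pos (-(l * s.re))).le
    rw [← hz, norm_sub_rev, Complex.norm_exp_I_mul_ofReal_sub_one, norm_mul, Real.norm_eq_abs,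
      Real.norm_eq_abs, abs_two] at h1
    have h2 : |Real.sin (-(l * s.im) / 2)| = |Real.sin (Real.pi * (R * l))| := by
      rcases eq_or_eq_neg_of_abs_eq him with h | h
      · rw [h, show -(l * (2 * Real.pi * R)) / 2 = -(Real.pi * (R * l)) by ring, Real.sin_neg,
          abs_neg]
      · rw [h]
        congr 2
        ring
    rw [h2] at h1
    linarith [two_mul_le_abs_sin h]
  · refine (min_le_right _ _).trans ?_
    have h1 : ‖Complex.exp (-(l * s))‖ ≤ Real.exp (-l) := by
      rw [Complex.norm_exp, Complex.neg_re, Complex.re_ofReal_mul, hre]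
      apply Real.exp_le_exp.2
      have : 1 ≤ 2 * Real.pi * R := by nlinarith
      nlinarith
    have h2 := norm_sub_norm_le 1 (Complex.exp (-(l * s)))
    rw [norm_one] at h2
    linarith

theorem prod_gap_le_norm {L : Fin n → ℝ} (hL : ∀ m, 0 < L m) {δ R : ℝ} (hδ : 0 < δ) (hR : 1 ≤ R)
    (h : R ∈ admissibleFor L δ) {s : ℂ} (hs : s ∈ halfSquare (2 * Real.pi * R)) :
    ∏ m, gap δ (L m) ≤ ‖∏ m, (1 - Complex.exp (-(L m * s)))‖ := by
  rw [norm_prod]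
  exact Finset.prod_le_prod (fun m _ => (gap_pos hδ (hL m)).le)
    fun m _ => gap_le_norm (hL m) hR (h m) hs

/-- Since `1 - e^{ls} = -e^{ls} (1 - e^{-ls})`, reflection gains the factor `e^{-(∑ L m) s}`. Its
rate is positive because `n ≥ 1`. -/
theorem tendsto_halfSquareIntegral_expKernel_neg {L : Fin n → ℝ} (hn : 1 ≤ n)
    (hL : ∀ m, 0 < L m) {u δ : ℝ} (hu : 0 ≤ u) (hδ : 0 < δ) :
    Tendsto (fun R => halfSquareIntegral (fun s => expKernel L u (-s)) (2 * Real.pi * R))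
      (atTop ⊓ 𝓟 (admissibleFor L δ)) (𝓝 0) := by
  have hg : 0 < ∏ m, gap δ (L m) := Finset.prod_pos fun m _ => gap_pos hδ (hL m)
  have hsum : 0 < ∑ m, L m :=
    Finset.sum_pos (fun m _ => hL m) ⟨⟨0, hn⟩, Finset.mem_univ _⟩
  refine tendsto_halfSquareIntegral_zero (C := (∏ m, gap δ (L m))⁻¹) inf_le_left (by positivity)
    hsum ?_
  filter_upwards [mem_inf_of_left (eventually_ge_atTop (1 : ℝ)),
    mem_inf_of_right (mem_principal_self (admissibleFor L δ))] with R hR hadm s hs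
  have hT : 0 < 2 * Real.pi * R := by positivity
  have h1 : ∏ m, (1 - Complex.exp (-(L m * -s)))
      = (-1) ^ n * Complex.exp ((∑ m, L m : ℝ) * s) * ∏ m, (1 - Complex.exp (-(L m * s))) := by
    have h2 : ∀ m : Fin n, 1 - Complex.exp (-(L m * -s))
        = (-1) * Complex.exp (L m * s) * (1 - Complex.exp (-(L m * s))) := by
      intro m
      have : Complex.exp (L m * s) * Complex.exp (-(L m * s)) = 1 := by
        rw [← Complex.exp_add, add_neg_cancel, Complex.exp_zero]
      rw [mul_neg, neg_neg]
      linear_combination -this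
    rw [Finset.prod_congr rfl fun m _ => h2 m, Finset.prod_mul_distrib, Finset.prod_mul_distrib,
      Finset.prod_const, Finset.card_univ, Fintype.card_fin, ← Complex.exp_sum]
    push_cast
    rw [Finset.sum_mul]
  unfold expKernel
  rw [h1, norm_div, norm_mul, norm_mul, norm_mul, norm_neg, norm_pow, norm_neg, norm_one, one_pow,
    one_mul, Complex.norm_exp, Complex.norm_exp, Complex.re_ofReal_mul, Complex.re_ofReal_mul,
    Complex.neg_re]
  have hb := prod_gap_le_norm hL hδ hR hadm hs
  have hns := le_norm_of_mem_halfSquare hs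
  calc Real.exp (u * -s.re) / (‖s‖ * (Real.exp ((∑ m, L m) * s.re)
        * ‖∏ m, (1 - Complex.exp (-(L m * s)))‖))
      ≤ 1 / ((2 * Real.pi * R) * (Real.exp ((∑ m, L m) * s.re) * ∏ m, gap δ (L m))) := by
        gcongr
        rw [Real.exp_le_one_iff]
        nlinarith [hs.1]
    _ = (∏ m, gap δ (L m))⁻¹ / (2 * Real.pi * R) * Real.exp (-(∑ m, L m) * s.re) := by
        rw [neg_mul, Real.exp_neg]
        field_simp

theorem norm_one_sub_prod_one_sub_le {ι : Type*} (P : Finset ι) {y : ι → ℂ} {η : ℝ}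
    (hη0 : 0 ≤ η) (hη : η ≤ 1) (hy : ∀ i ∈ P, ‖y i‖ ≤ η) :
    ‖1 - ∏ i ∈ P, (1 - y i)‖ ≤ 2 ^ P.card * η ∧
      ‖∏ i ∈ P, (1 - y i)‖ ≤ 2 ^ P.card := by
  classical
  induction P using Finset.induction_on with
  | empty => simpa using hη0
  | insert i P hi ih =>
    have h1 := ih fun j hj => hy j (Finset.mem_insert_of_mem hj)
    have h2 := hy i (Finset.mem_insert_self _ _)
    rw [Finset.prod_insert hi, Finset.card_insert_of_notMem hi, pow_succ]
    constructor
    · have : 1 - (1 - y i) * ∏ j ∈ P, (1 - y j)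
          = (1 - ∏ j ∈ P, (1 - y j)) + y i * ∏ j ∈ P, (1 - y j) := by ring
      rw [this]
      refine (norm_add_le _ _).trans ?_
      rw [norm_mul]
      have := mul_le_mul h2 h1.2 (norm_nonneg _) ((norm_nonneg _).trans h2)
      linarith [h1.1]
    · rw [norm_mul, mul_comm]
      have h3 : ‖1 - y i‖ ≤ 2 := by
        refine (norm_sub_le _ _).trans ?_
        rw [norm_one]
        linarith
      exact mul_le_mul h1.2 h3 (norm_nonneg _) (by positivity)

/-- A product of finite geometric sums, so no infinite Dirichlet series has to converge, not even on
the imaginary axis. -/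
theorem sum_exp_div_eq {L : Fin n → ℝ} (u : ℝ) {s : ℂ} (Q : ℕ)
    (hs : ∀ m, 1 - Complex.exp (-(L m * s)) ≠ 0) :
    ∑ q ∈ Fintype.piFinset fun _ : Fin n => Finset.range Q,
        Complex.exp ((u - ∑ m, q m * L m : ℝ) * s) / s
      = Complex.exp (u * s) / s * (∏ m, (1 - Complex.exp (-(L m * s))))⁻¹
        * ∏ m, (1 - Complex.exp (-(L m * s)) ^ Q) := by
  have h1 : ∀ m, ∑ q ∈ Finset.range Q, Complex.exp (-(L m * s)) ^ q
      = (1 - Complex.exp (-(L m * s)))⁻¹ * (1 - Complex.exp (-(L m * s)) ^ Q) := by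
    intro m
    rw [eq_inv_mul_iff_mul_eq₀ (hs m), mul_neg_geom_sum]
  rw [mul_assoc, ← Finset.prod_inv_distrib, ← Finset.prod_mul_distrib,
    ← Finset.prod_congr rfl fun m _ => h1 m, Finset.prod_univ_sum, Finset.mul_sum]
  refine Finset.sum_congr rfl fun q _ => ?_
  have h2 : Complex.exp ((u - ∑ m, q m * L m : ℝ) * s)
      = Complex.exp (u * s) * ∏ m, Complex.exp (-(L m * s)) ^ q m := by
    simp_rw [← Complex.exp_nat_mul]
    rw [← Complex.exp_sum, ← Complex.exp_add]
    congr 1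
    push_cast
    rw [sub_mul, Finset.sum_mul, sub_eq_add_neg, ← Finset.sum_neg_distrib]
    congr 1
    exact Finset.sum_congr rfl fun m _ => by ring
  rw [h2]
  ring

theorem tendsto_halfSquareIntegral_expKernel {L : Fin n → ℝ} (hL : ∀ m, 0 < L m) {u δ : ℝ}
    (hu : 0 ≤ u) (hδ : 0 < δ) {Q : ℕ} (hQ : ∀ m, u + 1 ≤ Q * L m) :
    Tendsto (fun R => halfSquareIntegral (expKernel L u) (2 * Real.pi * R))
      (atTop ⊓ 𝓟 (admissibleFor L δ)) (𝓝 (2 * Real.pi * Complex.I *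
        ∑ q ∈ Fintype.piFinset fun _ : Fin n => Finset.range Q,
          (step (u - ∑ m, q m * L m) : ℂ))) := by
  set P := Fintype.piFinset fun _ : Fin n => Finset.range Q with hP
  have hg : 0 < ∏ m, gap δ (L m) := Finset.prod_pos fun m _ => gap_pos hδ (hL m)
  set e : (Fin n → ℕ) → ℂ → ℂ := fun q s =>
    Complex.exp ((u - ∑ m, q m * L m : ℝ) * s) / s with he
  have hsum : Tendsto (fun R => ∑ q ∈ P, halfSquareIntegral (e q) (2 * Real.pi * R))
      (atTop ⊓ 𝓟 (admissibleFor L δ)) (𝓝 (2 * Real.pi * Complex.I *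
        ∑ q ∈ P, (step (u - ∑ m, q m * L m) : ℂ))) := by
    rw [Finset.mul_sum]
    exact tendsto_finsetSum _ fun q _ =>
      (tendsto_halfSquareIntegral_exp_mul_div _).mono_left inf_le_left
  have hev : ∀ᶠ R in atTop ⊓ 𝓟 (admissibleFor L δ), 1 ≤ R ∧ R ∈ admissibleFor L δ := by
    filter_upwards [mem_inf_of_left (eventually_ge_atTop (1 : ℝ)),
      mem_inf_of_right (mem_principal_self (admissibleFor L δ))] with R hR hadm
    exact ⟨hR, hadm⟩
  have hne : ∀ R, 1 ≤ R → R ∈ admissibleFor L δ → ∀ s ∈ halfSquare (2 * Real.pi * R),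
      ∀ m, 1 - Complex.exp (-(L m * s)) ≠ 0 := fun R hR hadm s hs m =>
    norm_pos_iff.1 ((gap_pos hδ (hL m)).trans_le (gap_le_norm (hL m) hR (hadm m) hs))
  have hrem : Tendsto (fun R => halfSquareIntegral
      (fun s => expKernel L u s + (-1) * ∑ q ∈ P, e q s) (2 * Real.pi * R))
      (atTop ⊓ 𝓟 (admissibleFor L δ)) (𝓝 0) := by
    refine tendsto_halfSquareIntegral_zero (C := (∏ m, gap δ (L m))⁻¹ * 2 ^ n) inf_le_left
      (by positivity) zero_lt_one ?_
    filter_upwards [hev] with R hR s hs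
    have hT : 0 < 2 * Real.pi * R := by
      have := hR.1
      positivity
    have h1 : expKernel L u s + (-1) * ∑ q ∈ P, e q s
        = Complex.exp (u * s) / s * ((∏ m, (1 - Complex.exp (-(L m * s))))⁻¹
          * (1 - ∏ m, (1 - Complex.exp (-(L m * s)) ^ Q))) := by
      have h2 : expKernel L u s
          = Complex.exp (u * s) / s * (∏ m, (1 - Complex.exp (-(L m * s))))⁻¹ := by
        rw [expKernel, ← div_div, div_eq_mul_inv (Complex.exp (u * s) / s)]
      rw [hP, he, sum_exp_div_eq u Q (hne R hR.1 hR.2 s hs), h2]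
      ring
    -- The condition `u + 1 ≤ Q * L m` makes the truncation error `O(e^{-(u+1) Re s})`. This
    -- outweighs `e^{u Re s}` and leaves decay at rate `1`.
    have h3 := (norm_one_sub_prod_one_sub_le Finset.univ
      (y := fun m => Complex.exp (-(L m * s)) ^ Q) (η := Real.exp (-((u + 1) * s.re)))
      (Real.exp_pos _).le
      (by
        rw [Real.exp_le_one_iff]
        nlinarith [hs.1])
      fun m _ => by
        rw [← Complex.exp_nat_mul, Complex.norm_exp, Real.exp_le_exp]
        have : ((Q : ℂ) * -(L m * s)).re = -(Q * L m * s.re) := by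
          simp [mul_assoc]
        rw [this]
        exact neg_le_neg (mul_le_mul_of_nonneg_right (hQ m) hs.1)).1
    rw [Finset.card_univ, Fintype.card_fin] at h3
    rw [h1, norm_mul, norm_mul, norm_inv]
    have h4 := norm_exp_mul_div_le (v := u) hT hs
    have h5 := prod_gap_le_norm hL hδ hR.1 hR.2 hs
    calc ‖Complex.exp (u * s) / s‖ * (‖∏ m, (1 - Complex.exp (-(L m * s)))‖⁻¹
          * ‖1 - ∏ m, (1 - Complex.exp (-(L m * s)) ^ Q)‖)
        ≤ (1 / (2 * Real.pi * R) * Real.exp (u * s.re)) * ((∏ m, gap δ (L m))⁻¹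
          * (2 ^ n * Real.exp (-((u + 1) * s.re)))) := by
          gcongr
      _ = (∏ m, gap δ (L m))⁻¹ * 2 ^ n / (2 * Real.pi * R)
          * (Real.exp (u * s.re) * Real.exp (-((u + 1) * s.re))) := by ring
      _ = (∏ m, gap δ (L m))⁻¹ * 2 ^ n / (2 * Real.pi * R) * Real.exp (-1 * s.re) := by
          rw [← Real.exp_add]
          congr 2
          ring
  have h := hrem.add hsum
  rw [zero_add] at h
  refine h.congr' ?_
  filter_upwards [hev] with R hR
  have hT : 0 < 2 * Real.pi * R := by
    have := hR.1
    positivity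
  have hec : ∀ q ∈ P, ContinuousOn (e q) (halfSquare (2 * Real.pi * R)) := fun q _ =>
    (squareContinuous_exp_mul_div _ hT).1
  have hesc : ContinuousOn (fun s => (-1) * ∑ q ∈ P, e q s) (halfSquare (2 * Real.pi * R)) :=
    continuousOn_const.mul (continuousOn_finsetSum P hec)
  have hFc : ContinuousOn (expKernel L u) (halfSquare (2 * Real.pi * R)) := fun s hs =>
    (analyticAt_expKernel (ne_zero_of_mem_halfSquare hT hs)
      (hne R hR.1 hR.2 s hs)).continuousAt.continuousWithinAt
  rw [halfSquareIntegral_add hT.le hFc hesc, halfSquareIntegral_const_mul,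
    halfSquareIntegral_sum P hT.le hec]
  ring

theorem tendsto_squareIntegral_expKernel {L : Fin n → ℝ} (hn : 1 ≤ n) (hL : ∀ m, 0 < L m)
    {u δ : ℝ} (hu : 0 ≤ u) (hδ : 0 < δ) {Q : ℕ} (hQ : ∀ m, u + 1 ≤ Q * L m) :
    Tendsto (fun R => squareIntegral (expKernel L u) (2 * Real.pi * R))
      (atTop ⊓ 𝓟 (admissibleFor L δ)) (𝓝 (2 * Real.pi * Complex.I *
        ∑ q ∈ Fintype.piFinset fun _ : Fin n => Finset.range Q,
          (step (u - ∑ m, q m * L m) : ℂ))) := by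
  simpa [squareIntegral] using (tendsto_halfSquareIntegral_expKernel hL hu hδ hQ).sub
    (tendsto_halfSquareIntegral_expKernel_neg hn hL hu hδ)

/-! ### The residues as trigonometric sums -/

theorem sum_Icc_neg_erase_zero {M : Type*} [AddCommMonoid M] (f : ℤ → M) (K : ℕ) :
    ∑ k ∈ (Finset.Icc (-(K : ℤ)) K).erase 0, f k
      = ∑ k ∈ Finset.Icc 1 K, (f k + f (-(k : ℤ))) := by
  induction K with
  | zero => simp
  | succ K ih =>
    have h : (Finset.Icc (-((K + 1 : ℕ) : ℤ)) ((K + 1 : ℕ) : ℤ)).erase 0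
        = insert ((K + 1 : ℕ) : ℤ) (insert (-((K + 1 : ℕ) : ℤ))
          ((Finset.Icc (-(K : ℤ)) K).erase 0)) := by
      ext k
      simp only [Finset.mem_erase, Finset.mem_Icc, Finset.mem_insert]
      omega
    rw [h, Finset.sum_insert, Finset.sum_insert, ih, Finset.sum_Icc_succ_top (by omega), add_comm,
      add_comm (f (-((K + 1 : ℕ) : ℤ))), add_assoc, add_comm (f (-((K + 1 : ℕ) : ℤ)))]
    · simp
    · simp only [Finset.mem_erase, Finset.mem_Icc, Finset.mem_insert]
      omega

theorem inv_one_sub_exp_eq {θ : ℝ} (hθ : 1 - Complex.exp (-(2 * θ * Complex.I)) ≠ 0) :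
    (1 - Complex.exp (-(2 * θ * Complex.I)))⁻¹
      = 2⁻¹ * (1 + (-Complex.I) * (Real.cot θ : ℂ)) := by
  have hE : Complex.exp (-(2 * θ * Complex.I)) = (Complex.cos θ - Complex.sin θ * Complex.I) ^ 2 := by
    rw [show -(2 * (θ : ℂ) * Complex.I) = ((2 : ℕ) : ℂ) * ((-θ : ℂ) * Complex.I) by push_cast; ring,
      Complex.exp_nat_mul, Complex.exp_mul_I, Complex.cos_neg, Complex.sin_neg]
    ring
  have h1 : Complex.sin θ ^ 2 + Complex.cos θ ^ 2 = 1 := Complex.sin_sq_add_cos_sq _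
  have hs : Complex.sin θ ≠ 0 := by
    intro h0
    apply hθ
    rw [hE]
    rw [h0] at h1 ⊢
    linear_combination -h1
  rw [inv_eq_iff_eq_inv, eq_comm]
  apply inv_eq_of_mul_eq_one_left
  have hI : Complex.I ^ 2 = -1 := Complex.I_sq
  have h2 : 1 - Complex.exp (-(2 * θ * Complex.I))
      = 2 * Complex.sin θ * (Complex.sin θ + Complex.cos θ * Complex.I) := by
    rw [hE]
    linear_combination -h1 - Complex.sin θ ^ 2 * hI
  rw [h2, Complex.ofReal_cot, Complex.cot]
  field_simp
  linear_combination h1 - Complex.cos θ ^ 2 * hI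

theorem conj_pole (l : ℝ) (k : ℤ) : (starRingEnd ℂ) (pole l k) = pole l (-k) := by
  rw [pole, pole, map_mul, Complex.conj_ofReal, Complex.conj_I]
  push_cast
  ring

theorem simpleResidue_neg (L : Fin n → ℝ) (u : ℝ) (m : Fin n) (k : ℤ) :
    simpleResidue L u m (-k) = (starRingEnd ℂ) (simpleResidue L u m k) := by
  unfold simpleResidue
  simp only [map_div₀, map_mul, map_prod, map_sub, map_one, ← Complex.exp_conj, map_neg, conj_pole,
    Complex.conj_ofReal]

/-- The `n - 1` factors `(1 - i cot) / 2` account for `2 ^ (n - 1)` and for the sum over subsets. -/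
theorem simpleResidue_eq {L : Fin n → ℝ} (hL : ∀ m, 0 < L m) (hi : Incommensurable L) (u : ℝ)
    (m : Fin n) {k : ℕ} (hk : k ≠ 0) :
    simpleResidue L u m k = ∑ I ∈ (Finset.univ.erase m).powerset,
      (((∏ l ∈ I, Real.cot (Real.pi * k * L l / L m)) / (2 ^ (n - 1) * (2 * Real.pi * k)) : ℝ) : ℂ)
        * (-Complex.I * Complex.exp
          ((2 * Real.pi * k * (u / L m) - Real.pi * (I.card : ℝ) / 2 : ℝ) * Complex.I)) := by
  have hLm : (L m : ℂ) ≠ 0 := by exact_mod_cast (hL m).ne'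
  have hk' : (k : ℂ) ≠ 0 := by exact_mod_cast hk
  have hpi : (Real.pi : ℂ) ≠ 0 := by exact_mod_cast Real.pi_ne_zero
  have hpole : ∀ l : Fin n, -((L l : ℂ) * pole (L m) k)
      = -(2 * (Real.pi * k * L l / L m : ℝ) * Complex.I) := by
    intro l
    unfold pole
    push_cast
    ring
  have hl : ∀ l ∈ Finset.univ.erase m,
      (1 - Complex.exp (-(L l * pole (L m) k)))⁻¹
        = 2⁻¹ * (1 + (-Complex.I) * (Real.cot (Real.pi * k * L l / L m) : ℂ)) := by
    intro l hlm
    have hne : 1 - Complex.exp (-(L l * pole (L m) k)) ≠ 0 := by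
      intro h
      obtain ⟨j, hj⟩ := (one_sub_exp_eq_zero_iff (hL l)).1 h
      rw [pole_eq_pole_iff (hL m) (hL l)] at hj
      exact hi m l (Finset.ne_of_mem_erase hlm).symm k j (by exact_mod_cast hk) hj
    rw [hpole] at hne ⊢
    exact inv_one_sub_exp_eq hne
  have hcard : (Finset.univ.erase m).card = n - 1 := by
    rw [Finset.card_erase_of_mem (Finset.mem_univ m), Finset.card_univ, Fintype.card_fin]
  have h1 : simpleResidue L u m k = Complex.exp (u * pole (L m) k) / (pole (L m) k * L m)
      * ∏ l ∈ Finset.univ.erase m, (1 - Complex.exp (-(L l * pole (L m) k)))⁻¹ := by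
    rw [simpleResidue, Finset.prod_inv_distrib, ← div_eq_mul_inv, div_div]
  rw [h1, Finset.prod_congr rfl hl, Finset.prod_mul_distrib, Finset.prod_const, hcard,
    Finset.prod_one_add, Finset.mul_sum, Finset.mul_sum]
  refine Finset.sum_congr rfl fun I _ => ?_
  rw [Finset.prod_mul_distrib, Finset.prod_const]
  -- The powers `(-i)^{|I|} = e^{-iπ|I|/2}` are the source of the phase shift in the sine.
  have h2 : Complex.exp ((2 * Real.pi * k * (u / L m) - Real.pi * (I.card : ℝ) / 2 : ℝ) * Complex.I)
      = Complex.exp (u * pole (L m) k) * (-Complex.I) ^ I.card := by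
    have h3 : (-Complex.I) = Complex.exp (-(Real.pi / 2) * Complex.I) := by
      rw [neg_mul, Complex.exp_neg, Complex.exp_pi_div_two_mul_I, Complex.inv_I]
    rw [h3, ← Complex.exp_nat_mul, ← Complex.exp_add]
    congr 1
    unfold pole
    push_cast
    ring
  rw [h2]
  have h4 : pole (L m) k * L m = 2 * Real.pi * k * Complex.I := by
    unfold pole
    push_cast
    field_simp
  rw [h4, ← Complex.ofReal_prod, inv_pow]
  generalize ∏ l ∈ I, Real.cot (Real.pi * k * L l / L m) = c
  push_cast
  field_simp
  rw [Complex.I_sq]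
  ring

theorem simpleResidue_add_neg {L : Fin n → ℝ} (hL : ∀ m, 0 < L m) (hi : Incommensurable L) (u : ℝ)
    (m : Fin n) {k : ℕ} (hk : k ≠ 0) :
    simpleResidue L u m k + simpleResidue L u m (-(k : ℤ))
      = ((1 / (2 ^ (n - 1) * Real.pi) * ∑ I ∈ (Finset.univ.erase m).powerset,
        Real.sin (2 * Real.pi * k * (u / L m) - Real.pi * (I.card : ℝ) / 2) / k
          * ∏ l ∈ I, Real.cot (Real.pi * k * L l / L m) : ℝ) : ℂ) := by
  rw [simpleResidue_neg, Complex.add_conj, simpleResidue_eq hL hi u m hk, Complex.re_sum]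
  congr 1
  rw [Finset.mul_sum, Finset.mul_sum]
  refine Finset.sum_congr rfl fun I _ => ?_
  rw [Complex.re_ofReal_mul, neg_mul, Complex.neg_re, Complex.I_mul_re,
    Complex.exp_ofReal_mul_I_im]
  have hk' : (k : ℝ) ≠ 0 := by exact_mod_cast hk
  have := Real.pi_ne_zero
  field_simp

/-- The trigonometric series attached to `m` and `I`, up to `⌊R L m⌋`. -/
def trigSum (L : Fin n → ℝ) (u : ℝ) (m : Fin n) (I : Finset (Fin n)) (R : ℝ) : ℝ :=
  ∑ k ∈ Finset.Icc 1 ⌊R * L m⌋₊,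
    Real.sin (2 * Real.pi * k * (u / L m) - Real.pi * (I.card : ℝ) / 2) / k *
      ∏ l ∈ I, Real.cot (Real.pi * k * L l / L m)

theorem sum_simpleResidue {L : Fin n → ℝ} (hL : ∀ m, 0 < L m) (hi : Incommensurable L) (u R : ℝ) :
    ∑ i ∈ poleIndices L R, simpleResidue L u i.1 i.2
      = ((1 / (2 ^ (n - 1) * Real.pi) *
        ∑ m, ∑ I ∈ (Finset.univ.erase m).powerset, trigSum L u m I R : ℝ) : ℂ) := by
  rw [poleIndices, Finset.sum_sigma, Finset.mul_sum, Complex.ofReal_sum]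
  refine Finset.sum_congr rfl fun m _ => ?_
  simp only [sum_Icc_neg_erase_zero]
  unfold trigSum
  rw [Finset.sum_comm, Finset.mul_sum, Complex.ofReal_sum]
  refine Finset.sum_congr rfl fun k hk => ?_
  exact simpleResidue_add_neg hL hi u m (by have := (Finset.mem_Icc.1 hk).1; omega)

/-! ### The Fourier series of the sawtooth function -/

/-- Dirichlet's test gives convergence on the unit circle away from `1`; Abel's limit theorem
identifies the value with the radial limit of the logarithm. -/
theorem tendsto_sum_pow_div {z : ℂ} (hz : ‖z‖ = 1) (hz1 : z ≠ 1) :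
    Tendsto (fun N : ℕ => ∑ i ∈ Finset.range N, z ^ i / i) atTop (𝓝 (-Complex.log (1 - z))) := by
  have hz1' : z - 1 ≠ 0 := sub_ne_zero.2 hz1
  have hcs : CauchySeq fun N : ℕ => ∑ i ∈ Finset.range N, (1 / ((i : ℝ) + 1)) • z ^ i := by
    refine Antitone.cauchySeq_series_mul_of_tendsto_zero_of_bounded (b := 2 / ‖z - 1‖) ?_
      tendsto_one_div_add_atTop_nhds_zero_nat fun N => ?_
    · intro i j hij
      have : (i : ℝ) ≤ j := by exact_mod_cast hij
      dsimp only
      gcongr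
    · rw [geom_sum_eq hz1, norm_div]
      gcongr
      refine (norm_sub_le _ _).trans ?_
      rw [norm_pow, hz, one_pow, norm_one]
      norm_num
  obtain ⟨ℓ, hℓ⟩ := cauchySeq_tendsto_of_complete hcs
  have hs : Tendsto (fun N : ℕ => ∑ i ∈ Finset.range N, z ^ i / i) atTop (𝓝 (z * ℓ)) := by
    -- The term `i = 0` is `1 / 0 = 0`, so the index can be shifted.
    rw [← tendsto_add_atTop_iff_nat 1]
    refine (hℓ.const_mul z).congr fun N => ?_
    rw [Finset.sum_range_succ', Finset.mul_sum]
    simp only [Nat.cast_zero, div_zero, add_zero]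
    refine Finset.sum_congr rfl fun i _ => ?_
    rw [Complex.real_smul]
    push_cast
    ring
  have habel := Complex.tendsto_tsum_powerSeries_nhdsWithin_lt hs
  rw [tendsto_map'_iff] at habel
  have hslit : 1 - z ∈ Complex.slitPlane := by
    rw [Complex.mem_slitPlane_iff]
    by_contra! h
    obtain ⟨h1, h2⟩ := h
    simp only [Complex.sub_re, Complex.one_re, Complex.sub_im, Complex.one_im, zero_sub,
      neg_eq_zero] at h1 h2
    have h3 : z.re ≤ 1 := hz ▸ Complex.re_le_norm z
    exact hz1 (Complex.ext (by simp; linarith) (by simpa using h2))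
  have hlog : Tendsto (fun r : ℝ => -Complex.log (1 - r * z)) (𝓝[<] 1)
      (𝓝 (-Complex.log (1 - z))) := by
    have hc : ContinuousAt (fun r : ℝ => -Complex.log (1 - r * z)) 1 := by
      refine (ContinuousAt.clog (by fun_prop) ?_).neg
      simpa using hslit
    have := hc.tendsto
    simp only [Complex.ofReal_one, one_mul] at this
    exact this.mono_left nhdsWithin_le_nhds
  have heq : z * ℓ = -Complex.log (1 - z) := by
    refine tendsto_nhds_unique habel (hlog.congr' ?_)
    filter_upwards [Ioo_mem_nhdsLT (zero_lt_one' ℝ)] with r hr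
    have hn : ‖(r : ℂ) * z‖ < 1 := by
      rw [norm_mul, hz, mul_one, Complex.norm_real, Real.norm_of_nonneg hr.1.le]
      exact hr.2
    rw [Function.comp_apply, ← (Complex.hasSum_taylorSeries_neg_log hn).tsum_eq]
    refine tsum_congr fun i => ?_
    rw [mul_pow]
    ring
  rwa [heq] at hs

/-- The polar form is `1 - e^{2πit} = 2 sin(πt) e^{i(πt - π/2)}`. -/
theorem arg_one_sub_exp {t : ℝ} (h0 : 0 < t) (h1 : t < 1) :
    (1 - Complex.exp ((2 * Real.pi * t : ℝ) * Complex.I)).arg = Real.pi * t - Real.pi / 2 := by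
  have hpi := Real.pi_pos
  have hs : 0 < Real.sin (Real.pi * t) :=
    Real.sin_pos_of_pos_of_lt_pi (by positivity) (by nlinarith)
  have h : 1 - Complex.exp ((2 * Real.pi * t : ℝ) * Complex.I)
      = ((2 * Real.sin (Real.pi * t) : ℝ) : ℂ) * (Complex.cos (Real.pi * t - Real.pi / 2 : ℝ)
        + Complex.sin (Real.pi * t - Real.pi / 2 : ℝ) * Complex.I) := by
    rw [← Complex.ofReal_cos, ← Complex.ofReal_sin, Real.cos_sub_pi_div_two,
      Real.sin_sub_pi_div_two, Complex.exp_mul_I, ← Complex.ofReal_cos, ← Complex.ofReal_sin,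
      mul_assoc 2 Real.pi, Real.cos_two_mul', Real.sin_two_mul]
    push_cast
    have := Complex.sin_sq_add_cos_sq (Real.pi * t)
    linear_combination -this
  rw [h, Complex.arg_mul_cos_add_sin_mul_I (by positivity)]
  constructor <;> nlinarith

theorem tendsto_sum_sin_div (y : ℝ) :
    Tendsto (fun N : ℕ => ∑ k ∈ Finset.Icc 1 N, Real.sin (2 * Real.pi * k * y) / k) atTop
      (𝓝 (-Real.pi * B1star y)) := by
  have hred : ∀ k : ℕ, Real.sin (2 * Real.pi * k * y) = Real.sin (2 * Real.pi * k * Int.fract y) := by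
    intro k
    have : 2 * Real.pi * k * y
        = 2 * Real.pi * k * Int.fract y + ((k * ⌊y⌋ : ℤ) : ℝ) * (2 * Real.pi) := by
      conv_lhs => rw [← Int.fract_add_floor y]
      push_cast
      ring
    rw [this, Real.sin_add_int_mul_two_pi]
  simp only [hred]
  by_cases hy : Int.fract y = 0
  · simp [hy, B1star]
  · have h0 : 0 < Int.fract y := lt_of_le_of_ne (Int.fract_nonneg y) (Ne.symm hy)
    have h1 := Int.fract_lt_one y
    set t := Int.fract y with ht
    set z := Complex.exp ((2 * Real.pi * t : ℝ) * Complex.I) with hz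
    have hzn : ‖z‖ = 1 := Complex.norm_exp_ofReal_mul_I _
    have hz1 : z ≠ 1 := by
      intro h
      have hs : 0 < Real.sin (Real.pi * t) :=
        Real.sin_pos_of_pos_of_lt_pi (by positivity) (by nlinarith [Real.pi_pos])
      have h4 : ‖Complex.exp (Complex.I * (2 * Real.pi * t : ℝ)) - 1‖ = 0 := by
        rw [mul_comm, ← hz, h, sub_self, norm_zero]
      rw [Complex.norm_exp_I_mul_ofReal_sub_one, norm_eq_zero,
        show 2 * Real.pi * t / 2 = Real.pi * t by ring] at h4
      linarith
    have hlim := (tendsto_sum_pow_div hzn hz1).comp (tendsto_add_atTop_nat 1)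
    have him := (Complex.continuous_im.tendsto _).comp hlim
    rw [Complex.neg_im, Complex.log_im, arg_one_sub_exp h0 h1] at him
    rw [show -Real.pi * B1star y = -(Real.pi * t - Real.pi / 2) by
      rw [B1star, if_neg hy]; ring]
    refine him.congr fun N => ?_
    have hterm : ∀ k : ℕ, (z ^ k / k).im = Real.sin (2 * Real.pi * k * t) / k := by
      intro k
      rw [hz, ← Complex.exp_nat_mul, ← Complex.ofReal_natCast, Complex.div_ofReal_im, ← mul_assoc,
        ← Complex.ofReal_mul, Complex.exp_ofReal_mul_I_im]
      congr 2
      ring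
    simp only [Function.comp_apply]
    induction N with
    | zero => simp
    | succ N ih =>
      rw [Finset.sum_range_succ, Complex.add_im, ih, hterm, Finset.sum_Icc_succ_top (by omega)]

/-! ### Admissible truncation parameters -/

/-- In `[R₀, T]` the excluded set is covered by intervals of length `2δ / L m`, at most `T L m + 2`
of them for each `m`. Their total length is at most `2nδT + C`, and `2nδ < 1` makes this less than
`T - R₀` for large `T`. -/
theorem exists_admissibleFor {L : Fin n → ℝ} (hL : ∀ m, 0 < L m) {δ : ℝ} (hδ0 : 0 < δ)
    (hn : 1 ≤ n) (hδ : δ < 1 / (2 * n)) {R₀ : ℝ} (hR₀ : 0 ≤ R₀) :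
    ∃ R ≥ R₀, R ∈ admissibleFor L δ := by
  by_contra! hcon
  have hn' : (1 : ℝ) ≤ n := by exact_mod_cast hn
  have hnδ : 0 < 1 - 2 * n * δ := by
    rw [lt_div_iff₀ (by positivity)] at hδ
    linarith
  have hδ2 : δ < 1 := by nlinarith
  set C : ℝ := ∑ m, 4 * δ / L m with hC
  have hC0 : 0 ≤ C := Finset.sum_nonneg fun m _ => by
    have := hL m
    positivity
  -- With this `T` the uncovered length `T - R₀ - (2nδT + C)` is at least `1`.
  set T : ℝ := (R₀ + C + 1) / (1 - 2 * n * δ) with hTdef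
  have hT0 : 0 ≤ T := by positivity
  have hT : T * (1 - 2 * n * δ) = R₀ + C + 1 := div_mul_cancel₀ _ hnδ.ne'
  have hcover : Set.Icc R₀ T ⊆ ⋃ m ∈ (Finset.univ : Finset (Fin n)),
      ⋃ k ∈ Finset.range (⌊T * L m⌋₊ + 2), Set.Ioo ((k - δ) / L m) ((k + δ) / L m) := by
    intro R hR
    have h1 := hcon R hR.1
    simp only [admissibleFor, Set.mem_ofPred_eq, not_forall, not_le] at h1
    obtain ⟨m, k, hk⟩ := h1
    rw [abs_lt] at hk
    have hR0 : 0 ≤ R := hR₀.trans hR.1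
    have hk0 : 0 ≤ k := by
      have h2 : (-1 : ℝ) < k := by
        have := mul_nonneg hR0 (hL m).le
        linarith
      have : (-1 : ℤ) < k := by exact_mod_cast h2
      omega
    lift k to ℕ using hk0
    simp only [Set.mem_iUnion]
    refine ⟨m, Finset.mem_univ m, k, ?_, ?_⟩
    · rw [Finset.mem_range]
      have h3 : (k : ℝ) < ⌊T * L m⌋₊ + 2 := by
        have h4 : R * L m ≤ T * L m := mul_le_mul_of_nonneg_right hR.2 (hL m).le
        have h5 := Nat.lt_floor_add_one (T * L m)
        simp only [Int.cast_natCast] at hk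
        linarith
      exact_mod_cast h3
    · rw [Set.mem_Ioo, div_lt_iff₀ (hL m), lt_div_iff₀ (hL m)]
      simp only [Int.cast_natCast] at hk
      constructor <;> linarith
  have hvol := MeasureTheory.measure_mono (μ := MeasureTheory.volume) hcover
  rw [Real.volume_Icc] at hvol
  have hle : ENNReal.ofReal (T - R₀)
      ≤ ∑ m, ∑ _k ∈ Finset.range (⌊T * L m⌋₊ + 2), ENNReal.ofReal (2 * δ / L m) := by
    refine hvol.trans ((MeasureTheory.measure_biUnion_finset_le _ _).trans ?_)
    refine Finset.sum_le_sum fun m _ => (MeasureTheory.measure_biUnion_finset_le _ _).trans ?_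
    refine Finset.sum_le_sum fun k _ => le_of_eq ?_
    rw [Real.volume_Ioo]
    congr 1
    ring
  have hnn : ∀ m, 0 ≤ 2 * δ / L m := fun m => by
    have := hL m
    positivity
  simp_rw [← ENNReal.ofReal_sum_of_nonneg fun _ _ => hnn _] at hle
  rw [← ENNReal.ofReal_sum_of_nonneg fun m _ => Finset.sum_nonneg fun _ _ => hnn m,
    ENNReal.ofReal_le_ofReal_iff
      (Finset.sum_nonneg fun m _ => Finset.sum_nonneg fun _ _ => hnn m)] at hle
  have hbound : ∑ m, ∑ _k ∈ Finset.range (⌊T * L m⌋₊ + 2), 2 * δ / L m ≤ 2 * n * δ * T + C := by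
    have h6 : 2 * n * δ * T + C = ∑ m : Fin n, (2 * δ * T + 4 * δ / L m) := by
      rw [Finset.sum_add_distrib, Finset.sum_const, Finset.card_univ, Fintype.card_fin,
        nsmul_eq_mul]
      ring
    rw [h6]
    refine Finset.sum_le_sum fun m _ => ?_
    rw [Finset.sum_const, Finset.card_range, nsmul_eq_mul]
    have h7 := Nat.floor_le (mul_nonneg hT0 (hL m).le)
    have h8 := hL m
    calc ((⌊T * L m⌋₊ + 2 : ℕ) : ℝ) * (2 * δ / L m) ≤ (T * L m + 2) * (2 * δ / L m) := by
          push_cast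
          gcongr
      _ = 2 * δ * T + 4 * δ / L m := by
          field_simp
          ring
  nlinarith

theorem frequently_admissibleFor {L : Fin n → ℝ} (hL : ∀ m, 0 < L m) {δ : ℝ} (hn : 1 ≤ n)
    (hδ : δ < 1 / (2 * n)) : ∃ᶠ R in atTop, R ∈ admissibleFor L δ := by
  rcases le_or_gt δ 0 with h | h
  · exact (Eventually.of_forall fun R m k => h.trans (abs_nonneg _)).frequently
  · refine frequently_atTop.2 fun R₀ => ?_
    obtain ⟨R, hR, hadm⟩ := exists_admissibleFor hL h hn hδ (le_max_right R₀ 0)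
    exact ⟨R, (le_max_left _ _).trans hR, hadm⟩

/-! ### Multiplicatively independent natural numbers -/

theorem powProd_single (a : Fin n → ℕ) (m : Fin n) (k : ℕ) :
    powProd a (Pi.single m k) = a m ^ k := by
  unfold powProd
  rw [Finset.prod_eq_single m]
  · simp
  · intro l _ hl
    simp [Pi.single_eq_of_ne hl]
  · simp

theorem two_le_of_injective {a : Fin n → ℕ} (ha : Function.Injective (powProd a)) (m : Fin n) :
    2 ≤ a m := by
  by_contra! h
  have h1 : powProd a (Pi.single m 1) = powProd a (Pi.single m 2) := by
    rw [powProd_single, powProd_single]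
    interval_cases a m <;> norm_num
  have := congrFun (ha h1) m
  simp at this

theorem log_pos_of_injective {a : Fin n → ℕ} (ha : Function.Injective (powProd a)) (m : Fin n) :
    0 < Real.log (a m) :=
  Real.log_pos (by exact_mod_cast two_le_of_injective ha m)

/-- Taking absolute values, a relation between two logarithms becomes `a l ^ |i| = a m ^ |j|`, two
exponent tuples with the same product. -/
theorem incommensurable_log {a : Fin n → ℕ} (ha : Function.Injective (powProd a)) :
    Incommensurable fun m => Real.log (a m) := by
  intro m l hml i j hi0 heq
  have hm := log_pos_of_injective ha m
  have hl := log_pos_of_injective ha l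
  have h1 : (i.natAbs : ℝ) * Real.log (a l) = j.natAbs * Real.log (a m) := by
    have := congrArg abs heq
    rw [abs_mul, abs_mul, abs_of_pos hm, abs_of_pos hl] at this
    rwa [Nat.cast_natAbs, Nat.cast_natAbs, Int.cast_abs, Int.cast_abs]
  have h2 : a l ^ i.natAbs = a m ^ j.natAbs := by
    rw [← Real.log_pow, ← Real.log_pow] at h1
    have hpos : ∀ (k : Fin n) (e : ℕ), (0 : ℝ) < (a k : ℝ) ^ e := fun k e => by
      have : 0 < a k := by linarith [two_le_of_injective ha k]
      positivity
    exact_mod_cast Real.log_injOn_pos (hpos l _) (hpos m _) h1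
  rw [← powProd_single, ← powProd_single] at h2
  have h3 := congrFun (ha h2) l
  rw [Pi.single_eq_same, Pi.single_eq_of_ne hml.symm] at h3
  exact hi0 (Int.natAbs_eq_zero.1 h3)

theorem kernel_eq_expKernel {a : Fin n → ℕ} (ha : ∀ m, 2 ≤ a m) {x : ℝ} (hx : 1 ≤ x) :
    kernel a x = expKernel (fun m => Real.log (a m)) (Real.log x) := by
  funext s
  have hx0 : (x : ℂ) ≠ 0 := by exact_mod_cast (by linarith : x ≠ 0)
  unfold kernel expKernel
  rw [Complex.cpow_def_of_ne_zero hx0, Complex.ofReal_log (by linarith)]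
  congr 2
  refine Finset.prod_congr rfl fun m _ => ?_
  have ham : (a m : ℂ) ≠ 0 := by
    have := ha m
    exact_mod_cast (by omega : a m ≠ 0)
  rw [Complex.cpow_def_of_ne_zero ham, Complex.exp_neg, one_div, Complex.ofReal_log (by positivity),
    Complex.ofReal_natCast]

theorem log_powProd {a : Fin n → ℕ} (ha : ∀ m, 2 ≤ a m) (q : Fin n → ℕ) :
    Real.log (powProd a q) = ∑ m, q m * Real.log (a m) := by
  unfold powProd
  push_cast
  rw [Real.log_prod fun m _ => ?_]
  · simp [Real.log_pow]
  · have := ha m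
    positivity

theorem powProd_pos {a : Fin n → ℕ} (ha : ∀ m, 2 ≤ a m) (q : Fin n → ℕ) : 0 < powProd a q :=
  Finset.prod_pos fun m _ => pow_pos (by linarith [ha m]) _

/-- Every tuple with product at most `x` lies in the box, because `q m * log (a m) ≤ log x < Q * log
(a m)`. By injectivity at most one tuple hits `x` exactly, and it loses `1/2`. -/
theorem sum_step_eq {a : Fin n → ℕ} (ha : Function.Injective (powProd a)) {x : ℝ} (hx : 1 ≤ x)
    {Q : ℕ} (hQ : ∀ m, Real.log x + 1 ≤ Q * Real.log (a m)) :
    ∑ q ∈ Fintype.piFinset fun _ : Fin n => Finset.range Q,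
        step (Real.log x - ∑ m, q m * Real.log (a m))
      = count a x - 1 / 2 * chi a x := by
  classical
  have ha2 := two_le_of_injective ha
  set P := Fintype.piFinset fun _ : Fin n => Finset.range Q with hP
  have hpos : ∀ q, (0 : ℝ) < powProd a q := fun q => by exact_mod_cast powProd_pos ha2 q
  have hx0 : 0 < x := by linarith
  have hmem : ∀ q, (powProd a q : ℝ) ≤ x → q ∈ P := by
    intro q hq
    rw [hP, Fintype.mem_piFinset]
    intro m
    rw [Finset.mem_range]
    have h1 := Real.log_le_log (hpos q) hq
    rw [log_powProd ha2] at h1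
    have hm := log_pos_of_injective ha m
    have h2 : q m * Real.log (a m) ≤ ∑ l, q l * Real.log (a l) :=
      Finset.single_le_sum (f := fun l => q l * Real.log (a l))
        (fun l _ => mul_nonneg (Nat.cast_nonneg _) (log_pos_of_injective ha l).le)
        (Finset.mem_univ m)
    have h3 : (q m : ℝ) < Q := by
      have := hQ m
      exact lt_of_mul_lt_mul_right (by linarith) hm.le
    exact_mod_cast h3
  have hstep : ∀ q, step (Real.log x - ∑ m, q m * Real.log (a m))
      = (if (powProd a q : ℝ) ≤ x then 1 else 0)
        - 1 / 2 * (if (powProd a q : ℝ) = x then 1 else 0) := by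
    intro q
    rw [← log_powProd ha2]
    unfold step
    rcases lt_trichotomy (powProd a q : ℝ) x with h | h | h
    · have := Real.log_lt_log (hpos q) h
      rw [if_neg (by linarith), if_neg (by linarith), if_pos h.le, if_neg h.ne]
      norm_num
    · rw [h]
      norm_num
    · have := Real.log_lt_log hx0 h
      rw [if_pos (by linarith), if_neg h.not_ge, if_neg h.ne']
      norm_num
  have hcount : ∑ q ∈ P, (if (powProd a q : ℝ) ≤ x then (1 : ℝ) else 0) = count a x := by
    rw [Finset.sum_boole, count]
    congr 1
    rw [← Set.ncard_coe_finset]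
    congr 1
    ext q
    simpa using hmem q
  have hchi : ∑ q ∈ P, (if (powProd a q : ℝ) = x then (1 : ℝ) else 0) = chi a x := by
    unfold chi
    by_cases hxS : x ∈ productSet a
    · rw [Set.indicator_of_mem hxS, Pi.one_apply]
      obtain ⟨q₀, hq₀⟩ := hxS
      rw [Finset.sum_eq_single q₀]
      · exact if_pos hq₀
      · intro q _ hq
        refine if_neg fun h => hq (ha ?_)
        exact Nat.cast_injective (R := ℝ) (h.trans hq₀.symm)
      · intro h
        exact absurd (hmem q₀ hq₀.le) h
    · rw [Set.indicator_of_notMem hxS]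
      exact Finset.sum_eq_zero fun q _ => if_neg fun h => hxS ⟨q, h⟩
  simp_rw [hstep]
  rw [Finset.sum_sub_distrib, ← Finset.mul_sum, hcount, hchi]

theorem sum_trigSum_eq (a : Fin n → ℕ) (x R : ℝ) :
    ∑ m, ∑ I ∈ (Finset.univ.erase m).powerset,
        trigSum (fun m => Real.log (a m)) (Real.log x) m I R
      = (∑ m, trigSum (fun m => Real.log (a m)) (Real.log x) m ∅ R) + truncatedSum a x R := by
  rw [truncatedSum, ← Finset.sum_add_distrib]
  refine Finset.sum_congr rfl fun m _ => ?_
  have hcard : (Finset.univ.erase m).card = n - 1 := by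
    rw [Finset.card_erase_of_mem (Finset.mem_univ m), Finset.card_univ, Fintype.card_fin]
  rw [Finset.sum_powerset, hcard, Finset.range_eq_Ico, Finset.sum_eq_sum_Ico_succ_bot (by omega),
    Finset.powersetCard_zero, Finset.sum_singleton]
  rfl

theorem tendsto_trigSum_empty {L : Fin n → ℝ} (hL : ∀ m, 0 < L m) (u : ℝ) (m : Fin n) :
    Tendsto (trigSum L u m ∅) atTop (𝓝 (-Real.pi * B1star (u / L m))) := by
  have h1 : Tendsto (fun R : ℝ => ⌊R * L m⌋₊) atTop atTop :=
    tendsto_nat_floor_atTop.comp (tendsto_id.atTop_mul_const (hL m))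
  refine ((tendsto_sum_sin_div (u / L m)).comp h1).congr fun R => ?_
  simp [trigSum]

end SmoothCount

end

/-! ### The explicit formula and the limit over admissible truncations -/

theorem theorem11 {n : ℕ} (hn : 1 ≤ n) (a : Fin n → ℕ) (ha : StrictMono a)
    (ha_indep : Function.Injective (SmoothCount.powProd a)) :
    (∀ δ : ℝ, δ < 1 / (2 * n) → ∃ᶠ R in Filter.atTop, R ∈ SmoothCount.admissible a δ) ∧
    ∀ x : ℝ, 1 ≤ x → ∀ δ : ℝ, 0 < δ →
      Filter.Tendsto
        (fun R : ℝ =>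
          SmoothCount.residue (SmoothCount.kernel a x) 0
            + ((-(1 / 2 ^ (n - 1)) * ∑ k, SmoothCount.B1star (Real.log x / Real.log (a k))
              + 1 / (2 ^ (n - 1) * Real.pi) * SmoothCount.truncatedSum a x R
              + 1 / 2 * SmoothCount.chi a x : ℝ) : ℂ))
        (Filter.atTop ⊓ Filter.principal (SmoothCount.admissible a δ))
        (nhds (SmoothCount.count a x : ℂ)) := by
  have hL := SmoothCount.log_pos_of_injective ha_indep
  have hi := SmoothCount.incommensurable_log ha_indep
  refine ⟨fun δ hδ => SmoothCount.frequently_admissibleFor hL hn hδ, fun x hx δ hδ => ?_⟩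
  have hu : 0 ≤ Real.log x := Real.log_nonneg hx
  have hadm : SmoothCount.admissible a δ
      = SmoothCount.admissibleFor (fun m => Real.log (a m)) δ := rfl
  rw [SmoothCount.kernel_eq_expKernel (SmoothCount.two_le_of_injective ha_indep) hx, hadm]
  obtain ⟨Q, hQ⟩ := exists_nat_ge ((Real.log x + 1) / Real.log 2)
  have hQ' : ∀ m, Real.log x + 1 ≤ Q * Real.log (a m) := by
    intro m
    rw [div_le_iff₀ (Real.log_pos one_lt_two)] at hQ
    refine hQ.trans (mul_le_mul_of_nonneg_left ?_ (Nat.cast_nonneg _))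
    exact Real.log_le_log two_pos
      (by exact_mod_cast SmoothCount.two_le_of_injective ha_indep m)
  have h1 := (SmoothCount.tendsto_squareIntegral_expKernel hn hL hu hδ hQ').const_mul
    (2 * (Real.pi : ℂ) * Complex.I)⁻¹
  rw [inv_mul_cancel_left₀ Complex.two_pi_I_ne_zero, ← Complex.ofReal_sum,
    SmoothCount.sum_step_eq ha_indep hx hQ'] at h1
  have h2 : Filter.Tendsto (fun R => ∑ m, SmoothCount.trigSum (fun m => Real.log (a m))
      (Real.log x) m ∅ R) Filter.atTop
      (nhds (∑ m, -Real.pi * SmoothCount.B1star (Real.log x / Real.log (a m)))) :=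
    tendsto_finsetSum _ fun m _ => SmoothCount.tendsto_trigSum_empty hL _ m
  -- This is the stated expression minus the sum of residues. Its sawtooth parts cancel in the limit
  -- and leave `χ / 2`, so the limit of `truncatedSum` never has to be known beforehand.
  have h3 := (((h2.const_mul (1 / (2 ^ (n - 1) * Real.pi))).const_sub
    (-(1 / 2 ^ (n - 1)) * ∑ k, SmoothCount.B1star (Real.log x / Real.log (a k)))).add_const
    (1 / 2 * SmoothCount.chi a x)).mono_left
      (inf_le_left : Filter.atTop ⊓ Filter.principal
        (SmoothCount.admissibleFor (fun m => Real.log (a m)) δ) ≤ Filter.atTop)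
  have h4 := h1.add ((Complex.continuous_ofReal.tendsto _).comp h3)
  have hval : ((SmoothCount.count a x - 1 / 2 * SmoothCount.chi a x : ℝ) : ℂ)
      + ((-(1 / 2 ^ (n - 1)) * ∑ k, SmoothCount.B1star (Real.log x / Real.log (a k))
        - 1 / (2 ^ (n - 1) * Real.pi)
          * ∑ m, -Real.pi * SmoothCount.B1star (Real.log x / Real.log (a m))
        + 1 / 2 * SmoothCount.chi a x : ℝ) : ℂ) = (SmoothCount.count a x : ℂ) := by
    rw [← Complex.ofReal_add, ← Complex.ofReal_natCast]
    congr 1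
    rw [← Finset.mul_sum]
    have := Real.pi_ne_zero
    field_simp
    ring
  rw [hval] at h4
  refine h4.congr' ?_
  filter_upwards [Filter.mem_inf_of_left (Filter.eventually_gt_atTop (0 : ℝ)),
    Filter.mem_inf_of_right (Filter.mem_principal_self _)] with R hR hRadm
  rw [SmoothCount.squareIntegral_expKernel hL hi _ hR hδ hRadm,
    inv_mul_cancel_left₀ Complex.two_pi_I_ne_zero, SmoothCount.sum_simpleResidue hL hi,
    SmoothCount.sum_trigSum_eq, add_assoc, Function.comp_apply, ← Complex.ofReal_add]
  congr 2
  ring
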